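/- Let $G=(V,E)$ be a finite undirected graph on $n=|V|$ vertices in which every vertex carries a self-loop, let $d$ be its maximum degree (the self-loop at a vertex counts as one incident edge), and let $\pi$ be a probability distribution on $V$ with $\pi(v)>0$ for all $v$. Write $\pi(S)=\sum_{v\in S}\pi(v)$. For $S\subseteq V$ let $\partial S=\{v\notin S : \exists u\in S,\ uv\in E\}$, and when $\pi(S)>0$ let $\psi(S)=\pi(\partial S)/\pi(S)$; put $$\psi(G)=\min\Big\{1,\ \min_{S\subseteq V:\ 0<\pi(S)\le 1/2}\psi(S)\Big\}.$$ Call a matrix $P\in\mathbb{R}_{\ge 0}^{V\times V}$ a *reweighting* if $P(u,v)=0$ for $uv\notin E$, $\sum_v P(u,v)=1$ for all $u$, and $\pi(u)P(u,v)=\pi(v)P(v,u)$ for all $uv\in E$. Then $I-P$ has $n$ real eigenvalues $\lambda_1(I-P)\le\dots\le\lambda_n(I-P)$, counted with multiplicity. For $1\le k\le n$ let $$\lambda_k^*(G)=\max_{P}\lambda_k(I-P),\qquad \sigma_k^*(G)=\max_{P}\sum_{i=1}^k\lambda_i(I-P),$$ where the maxima are over all reweightings $P$. Let $$\gamma^{(1)}(G)=\min_{f,g}\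 \sum_{v\in V}\pi(v)g(v)$$ over all $f:V\to\mathbb{R}$ and $g:V\to\mathbb{R}_{\ge0}$ with $\sum_v\pi(v)f(v)^2=1$, $\sum_v\pi(v)f(v)=0$, and $g(u)+g(v)\ge(f(u)-f(v))^2$ for all $uv\in E$. **Theorem.** There is an absolute constant $C>0$ such that, for all such $G$ and $\pi$ and every integer $k$ with $2\le k\le n$: 1. $\lambda_2^*(G)\le C\,\psi(G)$, and if $\lambda_k^*(G)>0$ then $$\psi(G)\le C\cdot\frac{k^{3/2}\,\lambda_2^*(G)\,\log d}{\sqrt{\lambda_k^*(G)}}.$$ 2. $\gamma^{(1)}(G)\le C\,\psi(G)$, and if $\sigma_k^*(G)>0$ then $$\psi(G)\le C\cdot k\,\gamma^{(1)}(G)\,\sqrt{\frac{k}{\sigma_k^*(G)}}.$$ -/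

import Mathlib

namespace VertexExpansion

noncomputable section

/-- The edge relation of the graph obtained from `G` by putting a self-loop on every vertex. -/
def LoopAdj {V : Type*} (G : SimpleGraph V) (u v : V) : Prop :=
  u = v ∨ G.Adj u v

/-- The degree of `v` in the graph with a self-loop on every vertex: the number of edges incident
to `v`, where the self-loop counts as one edge. -/
def loopDegree {V : Type*} [Fintype V] (G : SimpleGraph V) (v : V) : ℕ :=
  {u : V | LoopAdj G v u}.ncard

/-- The maximum degree of the graph with a self-loop on every vertex. -/
def maxDeg {V : Type*} [Fintype V] (G : SimpleGraph V) : ℕ :=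
  Finset.univ.sup (loopDegree G)

/-- `π` is a probability distribution on `V` with full support. -/
def IsPosDistribution {V : Type*} [Fintype V] (π : V → ℝ) : Prop :=
  (∀ v, 0 < π v) ∧ ∑ v, π v = 1

/-- The weight `π(S)`. -/
def weight {V : Type*} (π : V → ℝ) (S : Finset V) : ℝ :=
  ∑ v ∈ S, π v

open Classical in
/-- The vertex boundary `∂S`. -/
def vertexBoundary {V : Type*} [Fintype V] (G : SimpleGraph V) (S : Finset V) : Finset V :=
  {v : V | v ∉ S ∧ ∃ u ∈ S, LoopAdj G u v}

/-- The weighted vertex expansion `ψ(S) = π(∂S) / π(S)` of a set. -/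
def setExpansion {V : Type*} [Fintype V] (G : SimpleGraph V) (π : V → ℝ) (S : Finset V) : ℝ :=
  weight π (vertexBoundary G S) / weight π S

/-- The weighted vertex expansion `ψ(G)`: the minimum of `1` and of all `ψ(S)` with
`0 < π(S) ≤ 1/2`. It is the infimum of a finite nonempty set of reals. -/
def expansion {V : Type*} [Fintype V] (G : SimpleGraph V) (π : V → ℝ) : ℝ :=
  sInf (insert 1
    {x : ℝ | ∃ S : Finset V, 0 < weight π S ∧ weight π S ≤ 1 / 2 ∧ x = setExpansion G π S})

/-- `P` is the transition matrix of a `π`-reversible random walk on `G` with a self-loop on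
every vertex. -/
structure IsReweighting {V : Type*} [Fintype V] (G : SimpleGraph V) (π : V → ℝ)
    (P : Matrix V V ℝ) : Prop where
  nonneg : ∀ u v, 0 ≤ P u v
  support : ∀ u v, ¬ LoopAdj G u v → P u v = 0
  row_sum : ∀ u, ∑ v, P u v = 1
  reversible : ∀ u v, LoopAdj G u v → π u * P u v = π v * P v u

/-- `λ_i(M)`, the `i`-th smallest eigenvalue (`i = 1, 2, …`) of a real square matrix `M` all of
whose eigenvalues are real: the `i`-th entry of the increasing list of the roots of the
characteristic polynomial, with multiplicity. (If `π` is positive and `P` is a reweighting, then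
`1 - P` is similar to a real symmetric matrix, so this list has length `|V|`.) -/
def smallEigenvalue {V : Type*} [Fintype V] [DecidableEq V] (M : Matrix V V ℝ) (i : ℕ) : ℝ :=
  (M.charpoly.roots.sort (· ≤ ·)).getD (i - 1) 0

/-- `λ_k^*(G)`, the maximum reweighted `k`-th smallest eigenvalue of the normalized Laplacian. -/
def lambdaStar {V : Type*} [Fintype V] [DecidableEq V] (G : SimpleGraph V) (π : V → ℝ)
    (k : ℕ) : ℝ :=
  sSup {x : ℝ | ∃ P : Matrix V V ℝ, IsReweighting G π P ∧ x = smallEigenvalue (1 - P) k}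

/-- `σ_k^*(G)`, the maximum reweighted sum of the `k` smallest eigenvalues. -/
def sigmaStar {V : Type*} [Fintype V] [DecidableEq V] (G : SimpleGraph V) (π : V → ℝ)
    (k : ℕ) : ℝ :=
  sSup {x : ℝ | ∃ P : Matrix V V ℝ, IsReweighting G π P ∧
    x = ∑ i ∈ Finset.Icc 1 k, smallEigenvalue (1 - P) i}

/-- Feasibility of `(f, g)` for the one-dimensional dual program. -/
structure IsFeasibleOneDim {V : Type*} [Fintype V] (G : SimpleGraph V) (π : V → ℝ)
    (f g : V → ℝ) : Prop where
  nonneg : ∀ v, 0 ≤ g v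
  normalized : ∑ v, π v * f v ^ 2 = 1
  centered : ∑ v, π v * f v = 0
  edge : ∀ u v, LoopAdj G u v → (f u - f v) ^ 2 ≤ g u + g v

/-- `γ^{(1)}(G)`, the value of the one-dimensional dual program. -/
def gammaOne {V : Type*} [Fintype V] (G : SimpleGraph V) (π : V → ℝ) : ℝ :=
  sInf {x : ℝ | ∃ f g : V → ℝ, IsFeasibleOneDim G π f g ∧ x = ∑ v, π v * g v}

end

end VertexExpansion

/-! Easy directions. For π(S) ≤ 1/2 take the centred indicator f of S and let g be the indicator of
∂S. Every edge cut by S has an endpoint in ∂S, so (f, g) satisfies the edge constraints. Its norm is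
π(S)(1 - π(S)) ≥ π(S)/2 and its cost is π(∂S). This bounds `gammaOne` at once. It also bounds
`lambdaStar` at k = 2, because edge constraints bound the Dirichlet form of every reweighting by ∑ π
g.

Improved Cheeger inequality for γ. Start from a nearly optimal (f, g) of cost x = ∑ π g and truncate
f at a median, so that f ≥ 0 is supported on at most half of the weight. Choose thresholds 0 = t_0 ≤
t_1 ≤ ... greedily, so that the tent on each [t_i, t_{i+1}], composed with f, has squared norm c,
where c is slightly above x/σ_k. The tents are disjointly supported and their Dirichlet forms add up
to at most that of f, hence to at most x. If k steps did not exhaust the range of f, Ky Fan's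
inequality would give σ_k ≤ x/c for every reweighting, a contradiction. So k + 1 thresholds suffice,
and μ, the distance to the nearest threshold, satisfies ∑ π μ(f)² ≤ kc. Expansion applied to the
level sets of f, integrated against the density μ(t) dt, gives ψ ∑ π ∫_0^f μ ≲ ∑ π √g (μ(f) + √g).
The left side is at least of order ψ/k and the right side is at most x + √(xkc), which is of order x
√(k/σ_k).

From γ to λ. Convex separation shows that λ_2^* is at least the value of the relaxed dual program,
in which (f(u) - f(v))² is replaced by a convex combination d of such squared distances, that is, by
a vector-valued embedding. Random signs project the embedding to the line. Subgaussian tails over at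
most d neighbours cost a factor log d, so γ ≲ λ_2^* log d. Together with σ_k^* ≥ λ_k^* this turns
the second part of the theorem into the first. The main lemmas are `sum_eigenvalues_le`,
`expansion_le_of_truncated`, `exists_convexHull_of_lambdaStar_lt` and `gammaOne_le_of_convexHull`.
-/

namespace VertexExpansion

/-! ### Spectral theory of reweightings -/

/-- The quadratic form of an operator in an orthonormal basis of eigenvectors. -/
theorem inner_map_eq_sum {E : Type*} [NormedAddCommGroup E] [InnerProductSpace ℝ E] {n : ℕ}
    (b : OrthonormalBasis (Fin n) ℝ E) (μ : Fin n → ℝ) (T : E →ₗ[ℝ] E)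
    (hT : ∀ i, T (b i) = μ i • b i) (y : E) :
    inner ℝ y (T y) = ∑ i, μ i * inner ℝ (b i) y ^ 2 := by
  have h : T y = ∑ i, (inner ℝ (b i) y * μ i) • b i := by
    conv_lhs => rw [← b.sum_repr' y]
    simp [map_sum, hT, smul_smul]
  rw [h, inner_sum]
  refine Finset.sum_congr rfl fun i _ => ?_
  rw [inner_smul_right, real_inner_comm y (b i)]
  ring

/-- **Ky Fan's inequality** for the sum of the smallest eigenvalues. -/
theorem sum_eigenvalues_le {E : Type*} [NormedAddCommGroup E] [InnerProductSpace ℝ E] {n k : ℕ}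
    (b : OrthonormalBasis (Fin n) ℝ E) (μ : Fin n → ℝ) (hμ : Monotone μ) (T : E →ₗ[ℝ] E)
    (hT : ∀ i, T (b i) = μ i • b i) (hk : k ≤ n) (y : Fin k → E) (hy : Orthonormal ℝ y) :
    ∑ i : Fin k, μ (Fin.castLE hk i) ≤ ∑ i, inner ℝ (y i) (T (y i)) := by
  rcases Nat.eq_zero_or_pos k with rfl | hk0
  · simp
  -- The weights `w j` lie in [0, 1] and sum to k, so ∑ μ_j w_j is smallest when the weight sits on
  -- the first k indices.
  set w : Fin n → ℝ := fun j => ∑ i, inner ℝ (y i) (b j) ^ 2 with hw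
  have hw1 : ∀ j, w j ≤ 1 := fun j => by
    have := hy.sum_inner_products_le (s := Finset.univ) (b j)
    simpa [hw, Real.norm_eq_abs, sq_abs] using this
  have hw0 : ∀ j, 0 ≤ w j := fun j => Finset.sum_nonneg fun i _ => sq_nonneg _
  have hws : ∑ j, w j = k := by
    simp only [hw]
    rw [Finset.sum_comm]
    have : ∀ i, ∑ j, inner ℝ (y i) (b j) ^ 2 = 1 := fun i => by
      have h := b.sum_sq_norm_inner_right (y i)
      rw [hy.1 i] at h
      simpa [Real.norm_eq_abs, sq_abs, real_inner_comm] using h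
    simp [this]
  have hR : ∑ i, inner ℝ (y i) (T (y i)) = ∑ j, μ j * w j := by
    simp_rw [inner_map_eq_sum b μ T hT, hw, Finset.mul_sum]
    rw [Finset.sum_comm]
    simp_rw [real_inner_comm]
  -- Index of the k-th smallest eigenvalue. After subtracting `μ m`, the comparison holds term by
  -- term.
  set m : Fin n := Fin.castLE hk ⟨k - 1, by omega⟩ with hm
  have key : ∀ j : Fin n, (if (j : ℕ) < k then μ j - μ m else 0) ≤ (μ j - μ m) * w j := by
    intro j
    split_ifs with hj
    · have : μ j ≤ μ m := hμ (by simp only [hm, Fin.le_def, Fin.val_castLE]; omega)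
      nlinarith [hw1 j]
    · have : μ m ≤ μ j := hμ (by simp only [hm, Fin.le_def, Fin.val_castLE]; omega)
      exact mul_nonneg (by linarith) (hw0 j)
  have hsum := Finset.sum_le_sum fun j (_ : j ∈ Finset.univ) => key j
  have hL : ∑ j : Fin n, (if (j : ℕ) < k then μ j - μ m else 0)
      = ∑ i : Fin k, (μ (Fin.castLE hk i) - μ m) := by
    rw [← Finset.sum_filter]
    symm
    refine Finset.sum_bij (fun i _ => Fin.castLE hk i) (by simp) (by simp) ?_ (by simp)
    intro j hj
    exact ⟨⟨j, by simpa using hj⟩, by simp, rfl⟩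
  rw [hL] at hsum
  simp only [sub_mul, Finset.sum_sub_distrib, ← Finset.mul_sum, hws] at hsum
  simp at hsum
  rw [hR]
  linarith

/-- The isometry of `L²(π)` onto Euclidean space. -/
noncomputable def euclideanEmbedding {V : Type*} (π f : V → ℝ) : EuclideanSpace ℝ V :=
  WithLp.toLp 2 fun v => √(π v) * f v

theorem inner_euclideanEmbedding {V : Type*} [Fintype V] {π : V → ℝ} (hπ : IsPosDistribution π)
    (f g : V → ℝ) :
    inner ℝ (euclideanEmbedding π f) (euclideanEmbedding π g) = ∑ v, π v * f v * g v := by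
  simp only [euclideanEmbedding, PiLp.inner_apply, RCLike.inner_apply, conj_trivial]
  refine Finset.sum_congr rfl fun v _ => ?_
  have := Real.mul_self_sqrt (hπ.1 v).le
  linear_combination (f v * g v) * this

variable {V : Type*} [Fintype V] [DecidableEq V] {G : SimpleGraph V} {π : V → ℝ}

theorem LoopAdj.symm {V : Type*} {G : SimpleGraph V} {u v : V} (h : LoopAdj G u v) :
    LoopAdj G v u :=
  h.imp Eq.symm fun h' => h'.symm

theorem IsReweighting.symm {V : Type*} [Fintype V] {G : SimpleGraph V} {π : V → ℝ}
    {P : Matrix V V ℝ} (hP : IsReweighting G π P) (u v : V) :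
    π u * P u v = π v * P v u := by
  by_cases h : LoopAdj G u v
  · exact hP.reversible u v h
  · rw [hP.support u v h, hP.support v u fun h' => h h'.symm]
    simp

/-- Reversibility says that conjugating 1 - P by diag(√π) gives a symmetric matrix. The spectral
theorem applies to it, and conjugation preserves the characteristic polynomial from which
`smallEigenvalue` is read. -/
theorem IsReweighting.exists_eigenbasis (hπ : IsPosDistribution π) {P : Matrix V V ℝ}
    (hP : IsReweighting G π P) :
    ∃ (b : OrthonormalBasis (Fin (Fintype.card V)) ℝ (EuclideanSpace ℝ V))
      (μ : Fin (Fintype.card V) → ℝ) (T : EuclideanSpace ℝ V →ₗ[ℝ] EuclideanSpace ℝ V),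
      Monotone μ ∧ (∀ i, T (b i) = μ i • b i) ∧
      (∀ i : Fin (Fintype.card V), smallEigenvalue (1 - P) (i + 1) = μ i) ∧
      ∀ f, T (euclideanEmbedding π f) = euclideanEmbedding π ((1 - P).mulVec f) := by
  have hs : ∀ v, 0 < √(π v) := fun v => Real.sqrt_pos.2 (hπ.1 v)
  set S : (Matrix V V ℝ)ˣ :=
    ⟨Matrix.diagonal fun v => √(π v), Matrix.diagonal fun v => (√(π v))⁻¹,
      by simp [Matrix.diagonal_mul_diagonal, (hs _).ne'],
      by simp [Matrix.diagonal_mul_diagonal, (hs _).ne']⟩ with hS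
  set A : Matrix V V ℝ := (S : Matrix V V ℝ) * (1 - P) * ((S⁻¹ : (Matrix V V ℝ)ˣ) : Matrix V V ℝ)
    with hA
  have hchar : A.charpoly = (1 - P).charpoly := by
    rw [hA, Matrix.coe_units_inv]; exact Matrix.charpoly_units_conj S (1 - P)
  have hAe : ∀ u v, A u v = √(π u) * (1 - P) u v * (√(π v))⁻¹ := by
    intro u v
    have : ((S⁻¹ : (Matrix V V ℝ)ˣ) : Matrix V V ℝ) = Matrix.diagonal fun v => (√(π v))⁻¹ := rfl
    rw [hA, this, Matrix.mul_diagonal]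
    rw [show (S : Matrix V V ℝ) = Matrix.diagonal fun v => √(π v) from rfl, Matrix.diagonal_mul]
  have hH : A.IsHermitian := by
    ext u v
    rw [Matrix.conjTranspose_apply, star_trivial, hAe, hAe]
    rcases eq_or_ne u v with rfl | huv
    · rfl
    · rw [Matrix.sub_apply, Matrix.sub_apply, Matrix.one_apply_ne huv, Matrix.one_apply_ne huv.symm]
      have h := hP.symm u v
      have h1 := Real.mul_self_sqrt (hπ.1 u).le
      have h2 := Real.mul_self_sqrt (hπ.1 v).le
      have := (hs u).ne'
      have := (hs v).ne'
      field_simp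
      rw [sq, sq, h1, h2]
      linarith
  let e : Fin (Fintype.card V) ≃ V := (Fintype.equivFin V).symm
  let σ := Tuple.sort (hH.eigenvalues ∘ e)
  let τ : Fin (Fintype.card V) ≃ V := σ.trans e
  have hmono : Monotone (hH.eigenvalues ∘ τ) := Tuple.monotone_sort (hH.eigenvalues ∘ e)
  refine ⟨hH.eigenvectorBasis.reindex τ.symm, hH.eigenvalues ∘ τ, Matrix.toEuclideanLin A, hmono,
    ?_, ?_, ?_⟩
  · intro i
    have := hH.mulVec_eigenvectorBasis (τ i)
    rw [OrthonormalBasis.reindex_apply, Matrix.toLpLin_apply]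
    simp only [Equiv.symm_symm, this]
    rfl
  · intro i
    -- Two sorted lists with the same underlying multiset coincide. Hence the default value in
    -- `getD` is never reached.
    have hl : (1 - P).charpoly.roots.sort (· ≤ ·) = List.ofFn (hH.eigenvalues ∘ τ) := by
      refine List.Perm.eq_of_pairwise (le := (· ≤ ·)) (fun a b _ _ => le_antisymm)
        (Multiset.pairwise_sort _ _) ?_ ?_
      · rw [List.pairwise_ofFn]
        exact fun i j hij => hmono hij.le
      · rw [← Multiset.coe_eq_coe, Multiset.sort_eq, ← hchar, hH.roots_charpoly_eq_eigenvalues]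
        have : (List.ofFn (hH.eigenvalues ∘ τ) : Multiset ℝ)
            = Multiset.map (hH.eigenvalues ∘ τ) Finset.univ.val := by
          rw [Fin.univ_val_map]
        rw [this, ← Multiset.map_map _ τ]
        congr 1
        exact (Finset.map_univ_equiv τ ▸ rfl : (Finset.univ : Finset V).val
          = (Finset.univ.map τ.toEmbedding).val)
    rw [smallEigenvalue, hl]
    simp
  · intro f
    rw [Matrix.toLpLin_apply]
    ext u
    simp only [euclideanEmbedding, Matrix.mulVec, dotProduct, hAe, Finset.mul_sum]
    refine Finset.sum_congr rfl fun v _ => ?_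
    have := (hs v).ne'
    field_simp

/-- The Dirichlet form of a reweighting. -/
noncomputable def dirichletForm {V : Type*} [Fintype V] (π : V → ℝ) (P : Matrix V V ℝ)
    (f : V → ℝ) : ℝ :=
  (∑ u, ∑ v, π u * P u v * (f u - f v) ^ 2) / 2

theorem IsReweighting.sum_mul_mulVec {P : Matrix V V ℝ} (hP : IsReweighting G π P) (f : V → ℝ) :
    ∑ v, π v * f v * (1 - P).mulVec f v = dirichletForm π P f := by
  have h1 : ∀ u, (1 - P).mulVec f u = f u - ∑ v, P u v * f v := fun u => by
    rw [Matrix.sub_mulVec, Matrix.one_mulVec]; rfl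
  have h2 : ∑ u, ∑ v, π u * P u v * f u ^ 2 = ∑ u, π u * f u ^ 2 := by
    refine Finset.sum_congr rfl fun u _ => ?_
    rw [← Finset.sum_mul, ← Finset.mul_sum, hP.row_sum, mul_one]
  have h3 : ∑ u, ∑ v, π u * P u v * f v ^ 2 = ∑ u, π u * f u ^ 2 := by
    rw [Finset.sum_comm, ← h2]
    exact Finset.sum_congr rfl fun u _ => Finset.sum_congr rfl fun v _ => by rw [hP.symm v u]
  have h4 : ∑ u, ∑ v, π u * P u v * (f u - f v) ^ 2
      = ∑ u, ∑ v, π u * P u v * f u ^ 2 + ∑ u, ∑ v, π u * P u v * f v ^ 2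
        - 2 * ∑ u, ∑ v, π u * f u * (P u v * f v) := by
    simp only [Finset.mul_sum, ← Finset.sum_add_distrib, ← Finset.sum_sub_distrib]
    exact Finset.sum_congr rfl fun u _ => Finset.sum_congr rfl fun v _ => by ring
  rw [dirichletForm, h4, h2, h3]
  have h5 : ∑ u, π u * f u * (1 - P).mulVec f u
      = ∑ u, π u * f u ^ 2 - ∑ u, ∑ v, π u * f u * (P u v * f v) := by
    rw [← Finset.sum_sub_distrib]
    refine Finset.sum_congr rfl fun u _ => ?_
    rw [h1, ← Finset.mul_sum]
    ring
  rw [h5]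
  ring

theorem IsReweighting.dirichletForm_nonneg {V : Type*} [Fintype V] {G : SimpleGraph V}
    {π : V → ℝ} (hπ : IsPosDistribution π) {P : Matrix V V ℝ}
    (hP : IsReweighting G π P) (f : V → ℝ) : 0 ≤ dirichletForm π P f :=
  div_nonneg (Finset.sum_nonneg fun u _ => Finset.sum_nonneg fun v _ =>
    mul_nonneg (mul_nonneg (hπ.1 u).le (hP.nonneg u v)) (sq_nonneg _)) two_pos.le

theorem dirichletForm_smul {V : Type*} [Fintype V] (π : V → ℝ) (P : Matrix V V ℝ) (c : ℝ)
    (f : V → ℝ) : dirichletForm π P (fun v => c * f v) = c ^ 2 * dirichletForm π P f := by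
  simp only [dirichletForm, mul_div_assoc', Finset.mul_sum]
  congr 1
  exact Finset.sum_congr rfl fun u _ => Finset.sum_congr rfl fun v _ => by ring

/-- Ky Fan's inequality for a reweighting. -/
theorem IsReweighting.sum_smallEigenvalue_le (hπ : IsPosDistribution π) {P : Matrix V V ℝ}
    (hP : IsReweighting G π P) {k : ℕ} (hk : k ≤ Fintype.card V) (h : Fin k → V → ℝ)
    (horth : ∀ i j, i ≠ j → ∑ v, π v * h i v * h j v = 0)
    (hpos : ∀ i, 0 < ∑ v, π v * h i v ^ 2) :
    ∑ i ∈ Finset.Icc 1 k, smallEigenvalue (1 - P) i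
      ≤ ∑ i, dirichletForm π P (h i) / ∑ v, π v * h i v ^ 2 := by
  obtain ⟨b, μ, T, hμ, hT, hμe, hTe⟩ := hP.exists_eigenbasis hπ
  set N : Fin k → ℝ := fun i => ∑ v, π v * h i v ^ 2
  let y : Fin k → V → ℝ := fun i v => (√(N i))⁻¹ * h i v
  have hNs : ∀ i, √(N i) ≠ 0 := fun i => (Real.sqrt_pos.2 (hpos i)).ne'
  have hN2 : ∀ i, ((√(N i))⁻¹) ^ 2 = (N i)⁻¹ := fun i => by
    rw [inv_pow, Real.sq_sqrt (hpos i).le]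
  have hy : Orthonormal ℝ fun i => euclideanEmbedding π (y i) := by
    rw [orthonormal_iff_ite]
    intro i j
    rw [inner_euclideanEmbedding hπ]
    have : ∑ v, π v * y i v * y j v
        = (√(N i))⁻¹ * (√(N j))⁻¹ * ∑ v, π v * h i v * h j v := by
      rw [Finset.mul_sum]; exact Finset.sum_congr rfl fun v _ => by simp only [y]; ring
    rw [this]
    split_ifs with hij
    · subst hij
      have : ∑ v, π v * h i v * h i v = N i := Finset.sum_congr rfl fun v _ => by ring
      rw [this, ← sq, hN2, inv_mul_cancel₀ (hpos i).ne']
    · rw [horth i j hij, mul_zero]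
  have key := sum_eigenvalues_le b μ hμ T hT hk _ hy
  have hL : ∑ i ∈ Finset.Icc 1 k, smallEigenvalue (1 - P) i
      = ∑ i : Fin k, μ (Fin.castLE hk i) := by
    rw [← Finset.sum_congr rfl fun (i : Fin k) _ => hμe (Fin.castLE hk i)]
    simp only [Fin.val_castLE]
    rw [← Finset.sum_range (fun i => smallEigenvalue (1 - P) (i + 1)), Finset.range_eq_Ico,
      Finset.sum_Ico_add' (fun i => smallEigenvalue (1 - P) i) 0 k 1]
    rfl
  rw [hL]
  refine key.trans (le_of_eq (Finset.sum_congr rfl fun i _ => ?_))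
  rw [hTe, inner_euclideanEmbedding hπ, hP.sum_mul_mulVec, dirichletForm_smul, hN2,
    inv_mul_eq_div]

theorem IsReweighting.smallEigenvalue_nonneg (hπ : IsPosDistribution π) {P : Matrix V V ℝ}
    (hP : IsReweighting G π P) (i : Fin (Fintype.card V)) :
    0 ≤ smallEigenvalue (1 - P) (i + 1) := by
  obtain ⟨b, μ, T, hμ, hT, hμe, hTe⟩ := hP.exists_eigenbasis hπ
  rw [hμe]
  obtain ⟨f, hf⟩ : ∃ f, euclideanEmbedding π f = b i := by
    refine ⟨fun v => (√(π v))⁻¹ * b i v, ?_⟩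
    ext v
    simp [euclideanEmbedding, (Real.sqrt_pos.2 (hπ.1 v)).ne']
  have h : inner ℝ (b i) (T (b i)) = μ i := by
    rw [hT, inner_smul_right, real_inner_self_eq_norm_sq, b.orthonormal.1 i]; simp
  rw [← h, ← hf, hTe, inner_euclideanEmbedding hπ, hP.sum_mul_mulVec]
  exact hP.dirichletForm_nonneg hπ f

/-- A lower bound for the second eigenvalue from the Rayleigh quotients of centred functions. -/
theorem IsReweighting.le_smallEigenvalue_two (hπ : IsPosDistribution π) {P : Matrix V V ℝ}
    (hP : IsReweighting G π P) (hcard : 2 ≤ Fintype.card V) {s : ℝ}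
    (hs : ∀ f : V → ℝ, ∑ v, π v * f v ^ 2 = 1 → ∑ v, π v * f v = 0 → s ≤ dirichletForm π P f) :
    s ≤ smallEigenvalue (1 - P) 2 := by
  obtain ⟨b, μ, T, hμ, hT, hμe, hTe⟩ := hP.exists_eigenbasis hπ
  let i₀ : Fin (Fintype.card V) := ⟨0, by omega⟩
  let i₁ : Fin (Fintype.card V) := ⟨1, by omega⟩
  have h01 : i₀ ≠ i₁ := by simp [i₀, i₁]
  have hle : μ i₀ ≤ μ i₁ := hμ (by simp [i₀, i₁])
  have h2 : smallEigenvalue (1 - P) 2 = μ i₁ := hμe i₁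
  rw [h2]
  set o := euclideanEmbedding π (fun _ => (1 : ℝ)) with ho
  -- The span of the two lowest eigenvectors contains a unit vector orthogonal to the constants, and
  -- its Rayleigh quotient is at most `μ i₁`. Thus the constants need not be identified as the
  -- lowest eigenvector.
  obtain ⟨α, β, hαβ, hne⟩ : ∃ α β : ℝ, α * inner ℝ o (b i₀) + β * inner ℝ o (b i₁) = 0 ∧
      α ^ 2 + β ^ 2 = 1 := by
    by_cases h0 : inner ℝ o (b i₀) = 0
    · exact ⟨1, 0, by simp [h0], by norm_num⟩
    · set p := inner ℝ o (b i₀)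
      set q := inner ℝ o (b i₁)
      have hpq : 0 < q ^ 2 + p ^ 2 := by positivity
      have hr := (Real.sqrt_pos.2 hpq).ne'
      refine ⟨q / √(q ^ 2 + p ^ 2), -p / √(q ^ 2 + p ^ 2), by field_simp; ring, ?_⟩
      rw [div_pow, div_pow, Real.sq_sqrt hpq.le]
      field_simp
  set y := α • b i₀ + β • b i₁ with hy
  obtain ⟨f, hf⟩ : ∃ f, euclideanEmbedding π f = y := by
    refine ⟨fun v => (√(π v))⁻¹ * y v, ?_⟩
    ext v
    simp [euclideanEmbedding, (Real.sqrt_pos.2 (hπ.1 v)).ne']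
  have hb := orthonormal_iff_ite.1 b.orthonormal
  have hyy : inner ℝ y y = 1 := by
    simp only [hy, inner_add_left, inner_add_right, inner_smul_left, inner_smul_right, hb, h01,
      h01.symm, if_true, if_false]
    simp
    linarith
  have hyT : inner ℝ y (T y) = μ i₀ * α ^ 2 + μ i₁ * β ^ 2 := by
    simp only [hy, map_add, map_smul, hT, inner_add_left, inner_add_right, inner_smul_left,
      inner_smul_right, hb, h01, h01.symm, if_true, if_false]
    simp
    ring
  have hf1 : ∑ v, π v * f v ^ 2 = 1 := by
    rw [← hyy, ← hf, inner_euclideanEmbedding hπ]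
    exact Finset.sum_congr rfl fun v _ => by ring
  have hf0 : ∑ v, π v * f v = 0 := by
    have : inner ℝ o y = 0 := by rw [hy, inner_add_right, inner_smul_right, inner_smul_right, hαβ]
    rw [← this, ← hf, ho, inner_euclideanEmbedding hπ]
    simp
  have := hs f hf1 hf0
  rw [← hP.sum_mul_mulVec, ← inner_euclideanEmbedding hπ, ← hTe, hf, hyT] at this
  have h3 : μ i₁ * α ^ 2 + μ i₁ * β ^ 2 = μ i₁ := by rw [← mul_add, hne, mul_one]
  linarith [mul_le_mul_of_nonneg_right hle (sq_nonneg α)]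

end VertexExpansion

/-! ### Vertex expansion, the dual program and the easy directions -/

namespace VertexExpansion

section

variable {V : Type*} [Fintype V] {G : SimpleGraph V} {π : V → ℝ}

theorem weight_nonneg (hπ : IsPosDistribution π) (S : Finset V) : 0 ≤ weight π S :=
  Finset.sum_nonneg fun v _ => (hπ.1 v).le

theorem weight_mono (hπ : IsPosDistribution π) {S T : Finset V} (h : S ⊆ T) :
    weight π S ≤ weight π T :=
  Finset.sum_le_sum_of_subset_of_nonneg h fun v _ _ => (hπ.1 v).le

theorem setExpansion_nonneg (hπ : IsPosDistribution π) (S : Finset V) :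
    0 ≤ setExpansion G π S :=
  div_nonneg (weight_nonneg hπ _) (weight_nonneg hπ _)

theorem bddBelow_expansion (G : SimpleGraph V) (hπ : IsPosDistribution π) :
    BddBelow (insert 1
      {x : ℝ | ∃ S : Finset V, 0 < weight π S ∧ weight π S ≤ 1 / 2 ∧ x = setExpansion G π S}) := by
  refine ⟨0, ?_⟩
  rintro x (rfl | ⟨S, -, -, rfl⟩)
  · exact zero_le_one
  · exact setExpansion_nonneg hπ S

theorem expansion_le_one (G : SimpleGraph V) (hπ : IsPosDistribution π) : expansion G π ≤ 1 :=
  csInf_le (bddBelow_expansion G hπ) (Set.mem_insert _ _)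

theorem expansion_nonneg (G : SimpleGraph V) (hπ : IsPosDistribution π) : 0 ≤ expansion G π := by
  refine le_csInf (Set.insert_nonempty _ _) ?_
  rintro x (rfl | ⟨S, -, -, rfl⟩)
  · exact zero_le_one
  · exact setExpansion_nonneg hπ S

theorem expansion_mul_weight_le (hπ : IsPosDistribution π) {S : Finset V}
    (hS : weight π S ≤ 1 / 2) :
    expansion G π * weight π S ≤ weight π (vertexBoundary G S) := by
  rcases (weight_nonneg hπ S).eq_or_lt with h | h
  · rw [← h, mul_zero]
    exact weight_nonneg hπ _
  · rw [← le_div_iff₀ h]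
    exact csInf_le (bddBelow_expansion G hπ) (Set.mem_insert_of_mem _ ⟨S, h, hS, rfl⟩)

theorem le_mul_expansion {x c : ℝ} (hc : 0 < c) (h1 : x ≤ c)
    (h : ∀ S : Finset V, 0 < weight π S → weight π S ≤ 1 / 2 →
      x * weight π S ≤ c * weight π (vertexBoundary G S)) :
    x ≤ c * expansion G π := by
  rw [← div_le_iff₀' hc]
  refine le_csInf (Set.insert_nonempty _ _) ?_
  rintro y (rfl | ⟨S, hS, hS', rfl⟩)
  · rwa [div_le_one hc]
  · rw [setExpansion, div_le_div_iff₀ hc hS]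
    linarith [h S hS hS']

theorem IsPosDistribution.lt_one (hπ : IsPosDistribution π) (hcard : 2 ≤ Fintype.card V) (v : V) :
    π v < 1 := by
  classical
  have : Nontrivial V := Fintype.one_lt_card_iff_nontrivial.1 hcard
  obtain ⟨u, hu⟩ := exists_ne v
  have h := Finset.sum_le_sum_of_subset_of_nonneg (Finset.subset_univ {u, v})
    fun w _ _ => (hπ.1 w).le
  rw [hπ.2, Finset.sum_pair hu] at h
  linarith [hπ.1 u]

/-- Without edges other than the loops there is no expansion. -/
theorem expansion_eq_zero_of_forall_not_adj (hπ : IsPosDistribution π)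
    (hcard : 2 ≤ Fintype.card V) (hG : ∀ u v, ¬ G.Adj u v) : expansion G π = 0 := by
  classical
  refine le_antisymm ?_ (expansion_nonneg G hπ)
  have : Nontrivial V := Fintype.one_lt_card_iff_nontrivial.1 hcard
  obtain ⟨u, w, hu⟩ := exists_pair_ne V
  -- Two distinct vertices cannot both weigh more than one half.
  obtain ⟨v, hv⟩ : ∃ v, π v ≤ 1 / 2 := by
    by_contra! h
    have h' := Finset.sum_le_sum_of_subset_of_nonneg (Finset.subset_univ {u, w})
      fun w _ _ => (hπ.1 w).le
    rw [hπ.2, Finset.sum_pair hu] at h'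
    linarith [h u, h w]
  have h1 : weight π {v} = π v := by simp [weight]
  have h2 : vertexBoundary G {v} = ∅ := by
    ext x
    simp only [vertexBoundary, LoopAdj, Finset.mem_filter, Finset.mem_univ, true_and,
      Finset.mem_singleton, exists_eq_left, hG, or_false, Finset.notMem_empty, iff_false, not_and]
    exact fun h h' => h h'.symm
  have := expansion_mul_weight_le (G := G) hπ (S := {v}) (h1 ▸ hv)
  rw [h1, h2] at this
  have h3 : weight π (∅ : Finset V) = 0 := by simp [weight]
  rw [h3] at this
  by_contra! h
  linarith [mul_pos h (hπ.1 v)]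

/-- The centred indicator function of a set is a test function for the dual program. -/
theorem exists_test_of_finset (G : SimpleGraph V) (hπ : IsPosDistribution π) (S : Finset V) :
    ∃ f g : V → ℝ, (∀ v, 0 ≤ g v) ∧ ∑ v, π v * f v = 0 ∧
      ∑ v, π v * f v ^ 2 = weight π S * (1 - weight π S) ∧
      (∀ u v, LoopAdj G u v → (f u - f v) ^ 2 ≤ g u + g v) ∧
      ∑ v, π v * g v = weight π (vertexBoundary G S) := by
  classical
  set w := weight π S with hw
  have hi : ∑ v, π v * (if v ∈ S then (1 : ℝ) else 0) = w := by
    simp [hw, weight]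
  refine ⟨fun v => (if v ∈ S then 1 else 0) - w,
    fun v => if v ∈ vertexBoundary G S then 1 else 0, ?_, ?_, ?_, ?_, ?_⟩
  · intro v
    dsimp only
    split_ifs <;> norm_num
  · simp only [mul_sub, Finset.sum_sub_distrib, hi, ← Finset.sum_mul, hπ.2]
    ring
  · have : ∀ v, π v * ((if v ∈ S then (1 : ℝ) else 0) - w) ^ 2
        = (1 - 2 * w) * (π v * (if v ∈ S then (1 : ℝ) else 0)) + w ^ 2 * π v := fun v => by
      split_ifs <;> ring
    simp only [this, Finset.sum_add_distrib, ← Finset.mul_sum, hi, hπ.2]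
    ring
  · intro u v huv
    have hb : ∀ x y, LoopAdj G x y → x ∈ S → y ∉ S → y ∈ vertexBoundary G S := by
      intro x y hxy hx hy
      simp only [vertexBoundary, Finset.mem_filter, Finset.mem_univ, true_and]
      exact ⟨hy, x, hx, hxy⟩
    have hg : ∀ x, (0 : ℝ) ≤ if x ∈ vertexBoundary G S then 1 else 0 := fun x => by
      split_ifs <;> norm_num
    dsimp only
    by_cases hu : u ∈ S <;> by_cases hv : v ∈ S
    · simpa [hu, hv] using add_nonneg (hg u) (hg v)
    · have := hg u
      simp only [hu, hv, hb u v huv hu hv, if_true, if_false]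
      linarith
    · have := hg v
      simp only [hu, hv, hb v u huv.symm hv hu, if_true, if_false]
      linarith
    · simpa [hu, hv] using add_nonneg (hg u) (hg v)
  · simp [weight]

theorem exists_centered_of_two_le_card (hπ : IsPosDistribution π) (hcard : 2 ≤ Fintype.card V) :
    ∃ f : V → ℝ, ∑ v, π v * f v = 0 ∧ 0 < ∑ v, π v * f v ^ 2 := by
  have : Nontrivial V := Fintype.one_lt_card_iff_nontrivial.1 hcard
  obtain ⟨v, -⟩ := exists_pair_ne V
  obtain ⟨f, g, -, h0, h1, -, -⟩ := exists_test_of_finset (⊥ : SimpleGraph V) hπ {v}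
  refine ⟨f, h0, ?_⟩
  rw [h1]
  have : weight π {v} = π v := by simp [weight]
  rw [this]
  exact mul_pos (hπ.1 v) (by linarith [hπ.lt_one hcard v])

/-- The edge constraints bound the Dirichlet form of every reweighting. -/
theorem IsReweighting.dirichletForm_le (hπ : IsPosDistribution π) {P : Matrix V V ℝ}
    (hP : IsReweighting G π P) {f g : V → ℝ}
    (h : ∀ u v, LoopAdj G u v → (f u - f v) ^ 2 ≤ g u + g v) :
    dirichletForm π P f ≤ ∑ v, π v * g v := by
  have h1 : ∑ u, ∑ v, π u * P u v * (f u - f v) ^ 2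
      ≤ ∑ u, ∑ v, (π u * P u v * g u + π v * P v u * g v) := by
    refine Finset.sum_le_sum fun u _ => Finset.sum_le_sum fun v _ => ?_
    rw [← hP.symm u v, ← mul_add]
    by_cases huv : LoopAdj G u v
    · exact mul_le_mul_of_nonneg_left (h u v huv) (mul_nonneg (hπ.1 u).le (hP.nonneg u v))
    · simp [hP.support u v huv]
  have h2 : ∑ u, ∑ v, π u * P u v * g u = ∑ u, π u * g u := by
    refine Finset.sum_congr rfl fun u _ => ?_
    rw [← Finset.sum_mul, ← Finset.mul_sum, hP.row_sum, mul_one]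
  simp only [Finset.sum_add_distrib] at h1
  rw [Finset.sum_comm (f := fun u v => π v * P v u * g v), h2] at h1
  rw [dirichletForm]
  linarith

theorem bddBelow_gammaOne (G : SimpleGraph V) (hπ : IsPosDistribution π) :
    BddBelow {x : ℝ | ∃ f g : V → ℝ, IsFeasibleOneDim G π f g ∧ x = ∑ v, π v * g v} := by
  refine ⟨0, ?_⟩
  rintro x ⟨f, g, h, rfl⟩
  exact Finset.sum_nonneg fun v _ => mul_nonneg (hπ.1 v).le (h.nonneg v)

/-- The program is homogeneous: scaling f by a factor scales g by its square, so the normalization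
can be dropped. -/
theorem gammaOne_mul_le (hπ : IsPosDistribution π) {f g : V → ℝ} (hg : ∀ v, 0 ≤ g v)
    (h0 : ∑ v, π v * f v = 0) (hN : 0 < ∑ v, π v * f v ^ 2)
    (h : ∀ u v, LoopAdj G u v → (f u - f v) ^ 2 ≤ g u + g v) :
    gammaOne G π * ∑ v, π v * f v ^ 2 ≤ ∑ v, π v * g v := by
  set N := ∑ v, π v * f v ^ 2 with hNdef
  have hs : (√N)⁻¹ ^ 2 = N⁻¹ := by rw [inv_pow, Real.sq_sqrt hN.le]
  rw [← le_div_iff₀ hN]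
  refine csInf_le (bddBelow_gammaOne G hπ)
    ⟨fun v => (√N)⁻¹ * f v, fun v => N⁻¹ * g v, ⟨?_, ?_, ?_, ?_⟩, ?_⟩
  · exact fun v => mul_nonneg (inv_nonneg.2 hN.le) (hg v)
  · have : ∀ v, π v * ((√N)⁻¹ * f v) ^ 2 = N⁻¹ * (π v * f v ^ 2) := fun v => by
      rw [mul_pow, hs]; ring
    simp only [this, ← Finset.mul_sum, ← hNdef]
    exact inv_mul_cancel₀ hN.ne'
  · have : ∀ v, π v * ((√N)⁻¹ * f v) = (√N)⁻¹ * (π v * f v) := fun v => by ring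
    simp only [this, ← Finset.mul_sum, h0, mul_zero]
  · intro u v huv
    have := mul_le_mul_of_nonneg_left (h u v huv) (inv_nonneg.2 hN.le)
    rw [← mul_sub, mul_pow, hs]
    linarith
  · rw [div_eq_inv_mul, Finset.mul_sum]
    exact Finset.sum_congr rfl fun v _ => by ring

/-- The choice g = 2f² is always feasible, since (a - b)² ≤ 2a² + 2b². Without a feasible point the
infimum would be a default value. -/
theorem nonempty_gammaOne (G : SimpleGraph V) (hπ : IsPosDistribution π)
    (hcard : 2 ≤ Fintype.card V) :
    {x : ℝ | ∃ f g : V → ℝ, IsFeasibleOneDim G π f g ∧ x = ∑ v, π v * g v}.Nonempty := by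
  obtain ⟨f, h0, hN⟩ := exists_centered_of_two_le_card hπ hcard
  set N := ∑ v, π v * f v ^ 2 with hNdef
  have hs : (√N)⁻¹ ^ 2 = N⁻¹ := by rw [inv_pow, Real.sq_sqrt hN.le]
  refine ⟨_, fun v => (√N)⁻¹ * f v, fun v => 2 * ((√N)⁻¹ * f v) ^ 2,
    ⟨fun v => by positivity, ?_, ?_, ?_⟩, rfl⟩
  · have : ∀ v, π v * ((√N)⁻¹ * f v) ^ 2 = N⁻¹ * (π v * f v ^ 2) := fun v => by
      rw [mul_pow, hs]; ring
    simp only [this, ← Finset.mul_sum, ← hNdef]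
    exact inv_mul_cancel₀ hN.ne'
  · have : ∀ v, π v * ((√N)⁻¹ * f v) = (√N)⁻¹ * (π v * f v) := fun v => by ring
    simp only [this, ← Finset.mul_sum, h0, mul_zero]
  · intro u v _
    nlinarith [sq_nonneg ((√N)⁻¹ * f u + (√N)⁻¹ * f v)]

theorem gammaOne_nonneg (G : SimpleGraph V) (hπ : IsPosDistribution π)
    (hcard : 2 ≤ Fintype.card V) : 0 ≤ gammaOne G π := by
  refine le_csInf (nonempty_gammaOne G hπ hcard) ?_
  rintro x ⟨f, g, h, rfl⟩
  exact Finset.sum_nonneg fun v _ => mul_nonneg (hπ.1 v).le (h.nonneg v)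

/-- The easy direction for the one-dimensional dual program. -/
theorem gammaOne_le_two_mul_expansion (G : SimpleGraph V) (hπ : IsPosDistribution π)
    (hcard : 2 ≤ Fintype.card V) : gammaOne G π ≤ 2 * expansion G π := by
  refine le_mul_expansion two_pos ?_ ?_
  · obtain ⟨f, h0, hN⟩ := exists_centered_of_two_le_card hπ hcard
    have := gammaOne_mul_le (G := G) hπ (f := f) (g := fun v => 2 * f v ^ 2)
      (fun v => by positivity) h0 hN fun u v _ => by nlinarith [sq_nonneg (f u + f v)]
    have h2 : ∑ v, π v * (2 * f v ^ 2) = 2 * ∑ v, π v * f v ^ 2 := by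
      rw [Finset.mul_sum]; exact Finset.sum_congr rfl fun v _ => by ring
    rw [h2] at this
    exact le_of_mul_le_mul_right this hN
  · intro S hS hS'
    obtain ⟨f, g, hg, h0, h1, h2, h3⟩ := exists_test_of_finset G hπ S
    have hN : 0 < ∑ v, π v * f v ^ 2 := by rw [h1]; exact mul_pos hS (by linarith)
    have := gammaOne_mul_le hπ hg h0 hN h2
    rw [h3, h1] at this
    -- The factor 2 comes from 1 - π(S) ≥ 1/2.
    nlinarith [mul_nonneg (gammaOne_nonneg G hπ hcard) hS.le]

end

variable {V : Type*} [Fintype V] [DecidableEq V] {G : SimpleGraph V} {π : V → ℝ}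

theorem isReweighting_one (G : SimpleGraph V) (π : V → ℝ) : IsReweighting G π 1 where
  nonneg u v := by
    rw [Matrix.one_apply]
    split_ifs <;> norm_num
  support u v h := Matrix.one_apply_ne fun h' => h (Or.inl h')
  row_sum u := by simp [Matrix.one_apply]
  reversible u v _ := by
    rcases eq_or_ne u v with rfl | h
    · rfl
    · simp [Matrix.one_apply_ne h, Matrix.one_apply_ne h.symm]

/-- Ky Fan's inequality for the orthogonal pair 1, f. The constant has zero Dirichlet form and the
first eigenvalue is nonnegative. -/
theorem IsReweighting.smallEigenvalue_two_mul_le (hπ : IsPosDistribution π)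
    (hcard : 2 ≤ Fintype.card V) {P : Matrix V V ℝ} (hP : IsReweighting G π P) {f : V → ℝ}
    (h0 : ∑ v, π v * f v = 0) (hN : 0 < ∑ v, π v * f v ^ 2) :
    smallEigenvalue (1 - P) 2 * ∑ v, π v * f v ^ 2 ≤ dirichletForm π P f := by
  have h := hP.sum_smallEigenvalue_le hπ hcard ![fun _ => 1, f] (by
    intro i j hij
    fin_cases i <;> fin_cases j <;> simp_all) (by
    intro i
    fin_cases i
    · simp [hπ.2]
    · simpa using hN)
  have h1 : Finset.Icc 1 2 = {1, 2} := rfl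
  have h2 := hP.smallEigenvalue_nonneg hπ ⟨0, by omega⟩
  rw [h1, Finset.sum_pair (by norm_num), Fin.sum_univ_two] at h
  have h3 : dirichletForm π P (fun _ => 1) = 0 := by simp [dirichletForm]
  simp only [Matrix.cons_val_zero, Matrix.cons_val_one, h3, zero_div, zero_add] at h
  simp only [zero_add] at h2
  rw [← le_div_iff₀ hN]
  linarith

/-- Indicators of k distinct vertices are orthogonal and have Rayleigh quotient at most 1. This
makes the sets behind `sigmaStar` and `lambdaStar` bounded above, so that their suprema are genuine.
-/
theorem IsReweighting.sum_smallEigenvalue_le_card (hπ : IsPosDistribution π) {k : ℕ}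
    (hk : k ≤ Fintype.card V) {P : Matrix V V ℝ} (hP : IsReweighting G π P) :
    ∑ i ∈ Finset.Icc 1 k, smallEigenvalue (1 - P) i ≤ k := by
  let e : Fin k → V := fun i => (Fintype.equivFin V).symm (Fin.castLE hk i)
  have he : Function.Injective e :=
    (Fintype.equivFin V).symm.injective.comp (Fin.castLE_injective hk)
  have hN : ∀ i, ∑ v, π v * (if v = e i then (1 : ℝ) else 0) ^ 2 = π (e i) := fun i => by
    simp
  refine (hP.sum_smallEigenvalue_le hπ hk (fun i v => if v = e i then 1 else 0) ?_ ?_).trans ?_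
  · intro i j hij
    refine Finset.sum_eq_zero fun v _ => ?_
    by_cases h : v = e i
    · have : v ≠ e j := fun h' => hij (he (h.symm.trans h'))
      simp [this]
    · simp [h]
  · intro i
    rw [hN]
    exact hπ.1 _
  · have : ∀ i, dirichletForm π P (fun v => if v = e i then 1 else 0)
        / ∑ v, π v * (if v = e i then (1 : ℝ) else 0) ^ 2 ≤ 1 := fun i => by
      rw [hN, div_le_one (hπ.1 _)]
      refine (hP.dirichletForm_le hπ (g := fun v => if v = e i then 1 else 0) ?_).trans ?_
      · intro u v _
        split_ifs <;> norm_num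
      · simp
    exact (Finset.sum_le_sum fun i _ => this i).trans (by simp)

theorem IsReweighting.smallEigenvalue_le_sum (hπ : IsPosDistribution π) {k : ℕ} (hk0 : 1 ≤ k)
    (hk : k ≤ Fintype.card V) {P : Matrix V V ℝ} (hP : IsReweighting G π P) :
    smallEigenvalue (1 - P) k ≤ ∑ i ∈ Finset.Icc 1 k, smallEigenvalue (1 - P) i := by
  refine Finset.single_le_sum (f := fun i => smallEigenvalue (1 - P) i) (fun i hi => ?_)
    (Finset.mem_Icc.2 ⟨hk0, le_rfl⟩)
  rw [Finset.mem_Icc] at hi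
  have := hP.smallEigenvalue_nonneg hπ ⟨i - 1, by omega⟩
  simpa [Nat.sub_add_cancel hi.1] using this

theorem IsReweighting.sum_le_sigmaStar (hπ : IsPosDistribution π) {k : ℕ}
    (hk : k ≤ Fintype.card V) {P : Matrix V V ℝ} (hP : IsReweighting G π P) :
    ∑ i ∈ Finset.Icc 1 k, smallEigenvalue (1 - P) i ≤ sigmaStar G π k := by
  refine le_csSup ⟨k, ?_⟩ ⟨P, hP, rfl⟩
  rintro x ⟨Q, hQ, rfl⟩
  exact hQ.sum_smallEigenvalue_le_card hπ hk

theorem IsReweighting.le_lambdaStar (hπ : IsPosDistribution π) {k : ℕ} (hk0 : 1 ≤ k)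
    (hk : k ≤ Fintype.card V) {P : Matrix V V ℝ} (hP : IsReweighting G π P) :
    smallEigenvalue (1 - P) k ≤ lambdaStar G π k := by
  refine le_csSup ⟨k, ?_⟩ ⟨P, hP, rfl⟩
  rintro x ⟨Q, hQ, rfl⟩
  exact (hQ.smallEigenvalue_le_sum hπ hk0 hk).trans (hQ.sum_smallEigenvalue_le_card hπ hk)

theorem sigmaStar_le {k : ℕ} {x : ℝ}
    (h : ∀ P, IsReweighting G π P → ∑ i ∈ Finset.Icc 1 k, smallEigenvalue (1 - P) i ≤ x) :
    sigmaStar G π k ≤ x := by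
  refine csSup_le ⟨_, 1, isReweighting_one G π, rfl⟩ ?_
  rintro y ⟨P, hP, rfl⟩
  exact h P hP

theorem lambdaStar_le {k : ℕ} {x : ℝ}
    (h : ∀ P, IsReweighting G π P → smallEigenvalue (1 - P) k ≤ x) :
    lambdaStar G π k ≤ x := by
  refine csSup_le ⟨_, 1, isReweighting_one G π, rfl⟩ ?_
  rintro y ⟨P, hP, rfl⟩
  exact h P hP

theorem lambdaStar_le_sigmaStar (G : SimpleGraph V) (hπ : IsPosDistribution π) {k : ℕ}
    (hk0 : 1 ≤ k) (hk : k ≤ Fintype.card V) : lambdaStar G π k ≤ sigmaStar G π k :=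
  lambdaStar_le fun _ hP =>
    (hP.smallEigenvalue_le_sum hπ hk0 hk).trans (hP.sum_le_sigmaStar hπ hk)

theorem sigmaStar_le_card (G : SimpleGraph V) (hπ : IsPosDistribution π) {k : ℕ}
    (hk : k ≤ Fintype.card V) : sigmaStar G π k ≤ k :=
  sigmaStar_le fun _ hP => hP.sum_smallEigenvalue_le_card hπ hk

theorem lambdaStar_nonneg (G : SimpleGraph V) (hπ : IsPosDistribution π) {k : ℕ}
    (hk0 : 1 ≤ k) (hk : k ≤ Fintype.card V) : 0 ≤ lambdaStar G π k := by
  have h := (isReweighting_one G π).smallEigenvalue_nonneg hπ ⟨k - 1, by omega⟩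
  simp only [Nat.sub_add_cancel hk0] at h
  exact h.trans ((isReweighting_one G π).le_lambdaStar hπ hk0 hk)

/-- The easy direction for the reweighted second eigenvalue. -/
theorem lambdaStar_two_le_two_mul_expansion (G : SimpleGraph V) (hπ : IsPosDistribution π)
    (hcard : 2 ≤ Fintype.card V) : lambdaStar G π 2 ≤ 2 * expansion G π := by
  refine lambdaStar_le fun P hP => le_mul_expansion two_pos ?_ ?_
  · exact_mod_cast (hP.smallEigenvalue_le_sum hπ one_le_two hcard).trans
      (hP.sum_smallEigenvalue_le_card hπ hcard)
  · intro S hS hS'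
    obtain ⟨f, g, hg, h0, h1, h2, h3⟩ := exists_test_of_finset G hπ S
    have hN : 0 < ∑ v, π v * f v ^ 2 := by rw [h1]; exact mul_pos hS (by linarith)
    have := (hP.smallEigenvalue_two_mul_le hπ hcard h0 hN).trans (hP.dirichletForm_le hπ h2)
    rw [h3, h1] at this
    have hl := hP.smallEigenvalue_nonneg hπ ⟨1, by omega⟩
    norm_num at hl
    nlinarith [mul_nonneg hl hS.le]

end VertexExpansion

/-! ### Tent functions and the improved Cheeger inequality -/

namespace VertexExpansion

/-- The tent function on `[a, b]` with slopes `±1`. -/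
noncomputable def tent (a b x : ℝ) : ℝ := max 0 (min (x - a) (b - x))

theorem tent_nonneg (a b x : ℝ) : 0 ≤ tent a b x := le_max_left _ _

theorem tent_self (a x : ℝ) : tent a a x = 0 := by
  unfold tent
  apply max_eq_left
  rcases le_total x a with h | h
  · exact (min_le_left _ _).trans (by linarith)
  · exact (min_le_right _ _).trans (by linarith)

theorem continuous_tent (a b : ℝ) : Continuous (tent a b) := by
  unfold tent; fun_prop

theorem tent_eq_zero_of_le {a b x : ℝ} (h : x ≤ a) : tent a b x = 0 :=
  max_eq_left ((min_le_left _ _).trans (by linarith))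

theorem tent_eq_zero_of_ge {a b x : ℝ} (h : b ≤ x) : tent a b x = 0 :=
  max_eq_left ((min_le_right _ _).trans (by linarith))

theorem tent_mul_tent {t : ℕ → ℝ} (ht : Monotone t) {i j : ℕ} (hij : i ≠ j) (x : ℝ) :
    tent (t i) (t (i + 1)) x * tent (t j) (t (j + 1)) x = 0 := by
  wlog h : i < j generalizing i j
  · rw [mul_comm]
    exact this hij.symm (by omega)
  · rcases le_total x (t j) with h' | h'
    · rw [tent_eq_zero_of_le h', mul_zero]
    · rw [tent_eq_zero_of_ge ((ht h).trans h'), zero_mul]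

theorem sum_tent_sq {t : ℕ → ℝ} (ht : Monotone t) (k : ℕ) (x : ℝ) :
    (∑ i ∈ Finset.range k, tent (t i) (t (i + 1)) x) ^ 2
      = ∑ i ∈ Finset.range k, tent (t i) (t (i + 1)) x ^ 2 := by
  rw [sq, Finset.sum_mul_sum]
  refine Finset.sum_congr rfl fun i hi => ?_
  rw [Finset.sum_eq_single i (fun j _ hj => tent_mul_tent ht hj.symm x) (fun h => absurd hi h), sq]

/-- Here min x b - min x a is the length of the part of [a, b] below x. The tent is a 1-Lipschitz
function of this length, and the lengths telescope over consecutive intervals. -/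
theorem tent_eq_min {a b : ℝ} (hab : a ≤ b) (x : ℝ) :
    tent a b x = min (min x b - min x a) (b - a - (min x b - min x a)) := by
  rcases le_total x a with h | h
  · rw [tent_eq_zero_of_le h, min_eq_left h, min_eq_left (h.trans hab), sub_self,
      min_eq_left (by linarith)]
  · rw [min_eq_right h]
    rcases le_total x b with h' | h'
    · rw [min_eq_left h', tent, max_eq_right (le_min (by linarith) (by linarith))]
      congr 1
      ring
    · rw [tent_eq_zero_of_ge h', min_eq_right h', sub_self, min_eq_right (by linarith)]

theorem abs_tent_sub_le {a b x y : ℝ} (hab : a ≤ b) (hxy : x ≤ y) :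
    |tent a b x - tent a b y| ≤ (min y b - min y a) - (min x b - min x a) := by
  have h : min x b - min x a ≤ min y b - min y a := by
    rcases le_total x a with h1 | h1
    · rw [min_eq_left h1, min_eq_left (h1.trans hab), sub_self, sub_nonneg]
      exact min_le_min_left _ hab
    · rw [min_eq_right h1, min_eq_right (h1.trans hxy)]
      exact sub_le_sub_right (min_le_min_right _ hxy) _
  rw [tent_eq_min hab, tent_eq_min hab]
  refine (abs_min_sub_min_le_max _ _ _ _).trans (max_le ?_ ?_)
  · rw [abs_sub_comm, abs_of_nonneg (sub_nonneg.2 h)]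
  · rw [sub_sub_sub_cancel_left, abs_of_nonneg (sub_nonneg.2 h)]

theorem sum_abs_tent_sub_le {t : ℕ → ℝ} (ht : Monotone t) (k : ℕ) (x y : ℝ) :
    ∑ i ∈ Finset.range k, |tent (t i) (t (i + 1)) x - tent (t i) (t (i + 1)) y| ≤ |x - y| := by
  wlog hxy : x ≤ y generalizing x y
  · simp_rw [abs_sub_comm _ (tent _ _ y), abs_sub_comm x y]
    exact this y x (le_of_not_ge hxy)
  refine (Finset.sum_le_sum fun i _ => abs_tent_sub_le (ht i.le_succ) hxy).trans ?_
  rw [Finset.sum_sub_distrib, Finset.sum_range_sub (fun i => min y (t i)),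
    Finset.sum_range_sub (fun i => min x (t i)), abs_sub_comm, abs_of_nonneg (sub_nonneg.2 hxy)]
  have h1 : min x (t 0) ≤ min y (t 0) := min_le_min_right _ hxy
  have h2 : min y (t k) ≤ min x (t k) + (y - x) := by
    rcases le_total x (t k) with h | h
    · rw [min_eq_left h]; exact (min_le_left _ _).trans (by linarith)
    · rw [min_eq_right h]; exact (min_le_right _ _).trans (by linarith)
  linarith

/-- Nonnegative numbers have a sum of squares at most the square of their sum. Consequently the
Dirichlet forms of the k tents of f add up to at most that of f, with no loss depending on k. -/
theorem sum_tent_sub_sq_le {t : ℕ → ℝ} (ht : Monotone t) (k : ℕ) (x y : ℝ) :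
    ∑ i ∈ Finset.range k, (tent (t i) (t (i + 1)) x - tent (t i) (t (i + 1)) y) ^ 2
      ≤ (x - y) ^ 2 := by
  have h := Finset.sum_sq_le_sq_sum_of_nonneg (s := Finset.range k)
    (f := fun i => |tent (t i) (t (i + 1)) x - tent (t i) (t (i + 1)) y|) fun i _ => abs_nonneg _
  simp only [sq_abs] at h
  rw [← sq_abs (x - y)]
  exact h.trans (pow_le_pow_left₀ (Finset.sum_nonneg fun i _ => abs_nonneg _)
    (sum_abs_tent_sub_le ht k x y) 2)

theorem integral_tent_self {a b : ℝ} (hab : a ≤ b) :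
    (b - a) ^ 2 / 4 = ∫ s in a..b, tent a b s := by
  have hc := continuous_tent a b
  set m := (a + b) / 2 with hm
  rw [← intervalIntegral.integral_add_adjacent_intervals (b := m)
    (hc.intervalIntegrable _ _) (hc.intervalIntegrable _ _)]
  have h1 : ∫ s in a..m, tent a b s = ∫ s in a..m, (s - a) := by
    refine intervalIntegral.integral_congr fun s hs => ?_
    rw [Set.uIcc_of_le (by linarith)] at hs
    simp only [tent]
    rw [min_eq_left (by linarith [hs.2]), max_eq_right (by linarith [hs.1])]
  have h2 : ∫ s in m..b, tent a b s = ∫ s in m..b, (b - s) := by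
    refine intervalIntegral.integral_congr fun s hs => ?_
    rw [Set.uIcc_of_le (by linarith)] at hs
    simp only [tent]
    rw [min_eq_right (by linarith [hs.1]), max_eq_right (by linarith [hs.2])]
  rw [h1, h2, intervalIntegral.integral_sub (by simp) (by simp),
    intervalIntegral.integral_sub (by simp) (by simp)]
  simp only [integral_id, intervalIntegral.integral_const, smul_eq_mul]
  rw [hm]
  ring

/-- The tent on [a, b] dominates the tent on the shorter interval [a, min x b], whose integral is a
quarter of the squared length. -/
theorem le_integral_tent {a b x : ℝ} (ha : 0 ≤ a) (hab : a ≤ b) (hx : 0 ≤ x) :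
    (min x b - min x a) ^ 2 / 4 ≤ ∫ s in (0 : ℝ)..x, tent a b s := by
  have hc := continuous_tent a b
  rcases le_total x a with h | h
  · rw [min_eq_left h, min_eq_left (h.trans hab)]
    simpa using intervalIntegral.integral_nonneg hx fun s _ => tent_nonneg a b s
  · rw [min_eq_right h]
    have hay : a ≤ min x b := le_min h hab
    rw [integral_tent_self hay]
    refine (intervalIntegral.integral_mono_on hay ((continuous_tent _ _).intervalIntegrable _ _)
      (hc.intervalIntegrable _ _) fun s _ => ?_).trans
      (intervalIntegral.integral_mono_interval (c := 0) (d := x) ha hay (min_le_left _ _)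
        (Filter.Eventually.of_forall fun s => tent_nonneg a b s) (hc.intervalIntegrable _ _))
    exact max_le_max_left _ (min_le_min_left _ (sub_le_sub_right (min_le_right _ _) _))

/-- The lengths of the pieces of [0, x] sum to x, so by Cauchy–Schwarz their squares sum to at least
x²/k. -/
theorem le_integral_sum_tent {t : ℕ → ℝ} (ht : Monotone t) (h0 : t 0 = 0) {k : ℕ} (hk : 0 < k)
    {x : ℝ} (hx : 0 ≤ x) (hxk : x ≤ t k) :
    x ^ 2 / (4 * k) ≤ ∫ s in (0 : ℝ)..x, ∑ i ∈ Finset.range k, tent (t i) (t (i + 1)) s := by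
  rw [intervalIntegral.integral_finsetSum fun i _ => (continuous_tent _ _).intervalIntegrable _ _]
  have h1 : ∑ i ∈ Finset.range k, (min x (t (i + 1)) - min x (t i)) = x := by
    rw [Finset.sum_range_sub (fun i => min x (t i)), h0, min_eq_left hxk, min_eq_right hx, sub_zero]
  have h2 := sq_sum_le_card_mul_sum_sq (s := Finset.range k)
    (f := fun i => min x (t (i + 1)) - min x (t i))
  rw [h1, Finset.card_range] at h2
  have h3 := Finset.sum_le_sum fun i (_ : i ∈ Finset.range k) =>
    le_integral_tent (h0 ▸ ht (Nat.zero_le i) : 0 ≤ t i) (ht i.le_succ) hx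
  refine le_trans ?_ h3
  rw [← Finset.sum_div, div_le_div_iff₀ (by positivity) (by norm_num)]
  linarith

section

variable {V : Type*} [Fintype V] {G : SimpleGraph V} {π : V → ℝ}

/-- Every threshold set has a small vertex cover of its boundary edges. -/
theorem expansion_mul_threshold_le (hπ : IsPosDistribution π) {f r : V → ℝ}
    (hsupp : weight π {v | 0 < f v} ≤ 1 / 2)
    (hr : ∀ u v, LoopAdj G u v → f u - f v ≤ r u + r v) {t : ℝ} (ht : 0 ≤ t) :
    expansion G π * weight π {v | t < f v} ≤ 2 * weight π {v | |f v - t| ≤ r v} := by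
  classical
  set S : Finset V := {v | t < f v} with hS
  -- Vertices of S too close to the threshold are discarded. A neighbour of a remaining vertex can
  -- leave `S \ B` only by landing within its own radius of t.
  set B : Finset V := {v | t < f v ∧ f v - t ≤ r v} with hB
  set N : Finset V := {v | |f v - t| ≤ r v} with hN
  have hBN : B ⊆ N := fun v hv => by
    simp only [hB, hN, Finset.mem_filter, Finset.mem_univ, true_and] at hv ⊢
    rw [abs_of_pos (by linarith)]
    exact hv.2
  have hBS : B ⊆ S := fun v hv => by
    simp only [hB, hS, Finset.mem_filter, Finset.mem_univ, true_and] at hv ⊢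
    exact hv.1
  have hbd : vertexBoundary G (S \ B) ⊆ N := fun v hv => by
    simp only [vertexBoundary, hS, hB, hN, Finset.mem_filter, Finset.mem_univ, true_and,
      Finset.mem_sdiff, not_and, not_le] at hv ⊢
    obtain ⟨hv, u, ⟨hu, hu'⟩, huv⟩ := hv
    have h1 := hr u v huv
    have h2 := hu' hu
    rcases lt_or_ge t (f v) with h | h
    · rw [abs_of_pos (by linarith)]
      by_contra! h'
      exact hv h fun _ => h'
    · rw [abs_of_nonpos (by linarith)]
      linarith
  have hS2 : weight π (S \ B) ≤ 1 / 2 := by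
    refine (weight_mono hπ fun v hv => ?_).trans hsupp
    simp only [hS, Finset.mem_sdiff, Finset.mem_filter, Finset.mem_univ, true_and] at hv ⊢
    linarith [hv.1]
  have h1 := expansion_mul_weight_le (G := G) hπ hS2
  have h2 := weight_mono hπ hbd
  have h3 : weight π (S \ B) + weight π B = weight π S := Finset.sum_sdiff hBS
  have h4 := weight_mono hπ hBN
  -- The discarded part is charged by ψ π(B) ≤ π(B) ≤ π(N), which is why ψ(G) is capped at 1.
  have h5 := expansion_le_one G hπ
  have h6 := expansion_nonneg G hπ
  rw [← h3]
  nlinarith [weight_nonneg hπ B]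

theorem weight_filter_eq_sum (π : V → ℝ) (p : V → Prop) [DecidablePred p] :
    weight π {v | p v} = ∑ v, if p v then π v else 0 := by
  rw [weight, Finset.sum_filter]

/-- The threshold inequality integrated against a `1`-Lipschitz density. -/
theorem expansion_mul_integral_le (hπ : IsPosDistribution π) {f r : V → ℝ} (hf : ∀ v, 0 ≤ f v)
    (hr0 : ∀ v, 0 ≤ r v) (hsupp : weight π {v | 0 < f v} ≤ 1 / 2)
    (hr : ∀ u v, LoopAdj G u v → f u - f v ≤ r u + r v) {μ : ℝ → ℝ} (hμ0 : ∀ x, 0 ≤ μ x)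
    (hμ : ∀ x y, |μ x - μ y| ≤ |x - y|) :
    expansion G π * ∑ v, π v * ∫ s in (0 : ℝ)..f v, μ s
      ≤ 4 * ∑ v, π v * (r v * (μ (f v) + r v)) := by
  have hc : Continuous μ :=
    (LipschitzWith.of_dist_le_mul (K := 1) fun x y => by
      simpa [Real.dist_eq] using hμ x y).continuous
  set M := ∑ v, f v with hM
  have hfM : ∀ v, f v ≤ M := fun v =>
    Finset.single_le_sum (f := f) (fun u _ => hf u) (Finset.mem_univ v)
  have hint : ∀ s : Set ℝ, MeasurableSet s →
      MeasureTheory.IntegrableOn (s.indicator μ) (Set.Ioc 0 M) := fun s hs =>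
    ((hc.integrableOn_Icc (a := 0) (b := M)).mono_set Set.Ioc_subset_Icc_self).indicator hs
  have key : ∫ t in Set.Ioc 0 M, expansion G π * ∑ v, π v * (Set.Iio (f v)).indicator μ t
      ≤ ∫ t in Set.Ioc 0 M,
        2 * ∑ v, π v * (Set.Icc (f v - r v) (f v + r v)).indicator μ t := by
    refine MeasureTheory.setIntegral_mono_on ?_ ?_ measurableSet_Ioc fun t ht => ?_
    · exact (MeasureTheory.integrable_finsetSum _ fun v _ =>
        (hint _ measurableSet_Iio).const_mul _).const_mul _
    · exact (MeasureTheory.integrable_finsetSum _ fun v _ =>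
        (hint _ measurableSet_Icc).const_mul _).const_mul _
    · have h := mul_le_mul_of_nonneg_right
        (expansion_mul_threshold_le hπ hsupp hr ht.1.le) (hμ0 t)
      rw [weight_filter_eq_sum, weight_filter_eq_sum, mul_assoc, mul_assoc, Finset.sum_mul,
        Finset.sum_mul] at h
      convert h using 3 with v _ v _
      · simp only [Set.indicator_apply, Set.mem_Iio]
        split_ifs <;> simp
      · have : t ∈ Set.Icc (f v - r v) (f v + r v) ↔ |f v - t| ≤ r v := by
          rw [Set.mem_Icc, abs_le]
          constructor <;> rintro ⟨h1, h2⟩ <;> constructor <;> linarith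
        simp only [Set.indicator_apply, this]
        split_ifs <;> simp
  rw [MeasureTheory.integral_const_mul, MeasureTheory.integral_const_mul,
    MeasureTheory.integral_finsetSum _ fun v _ => (hint _ measurableSet_Iio).const_mul _,
    MeasureTheory.integral_finsetSum _ fun v _ => (hint _ measurableSet_Icc).const_mul _] at key
  simp only [MeasureTheory.integral_const_mul] at key
  have hL : ∀ v, ∫ t in Set.Ioc 0 M, (Set.Iio (f v)).indicator μ t = ∫ s in (0 : ℝ)..f v, μ s := by
    intro v
    rw [MeasureTheory.setIntegral_indicator measurableSet_Iio,
      intervalIntegral.integral_of_le (hf v), MeasureTheory.integral_Ioc_eq_integral_Ioo]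
    congr 2
    ext x
    simp only [Set.mem_inter_iff, Set.mem_Ioc, Set.mem_Iio, Set.mem_Ioo]
    exact ⟨fun h => ⟨h.1.1, h.2⟩, fun h => ⟨⟨h.1, h.2.le.trans (hfM v)⟩, h.2⟩⟩
  -- The window has length 2 r(v), and on it the Lipschitz density is at most μ(f v) + r v.
  have hR : ∀ v, ∫ t in Set.Ioc 0 M, (Set.Icc (f v - r v) (f v + r v)).indicator μ t
      ≤ 2 * (r v * (μ (f v) + r v)) := by
    intro v
    have hle : f v - r v ≤ f v + r v := by linarith [hr0 v]
    rw [MeasureTheory.setIntegral_indicator measurableSet_Icc]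
    refine (MeasureTheory.setIntegral_mono_set hc.integrableOn_Icc
      (Filter.Eventually.of_forall hμ0)
      (Filter.Eventually.of_forall Set.inter_subset_right)).trans ?_
    rw [MeasureTheory.integral_Icc_eq_integral_Ioc, ← intervalIntegral.integral_of_le hle]
    refine (intervalIntegral.integral_mono_on (g := fun _ => μ (f v) + r v) hle
      (hc.intervalIntegrable _ _) (by simp) fun x hx => ?_).trans (le_of_eq ?_)
    · have h1 := (le_abs_self _).trans (hμ x (f v))
      have h2 : |x - f v| ≤ r v := abs_le.2 ⟨by linarith [hx.1], by linarith [hx.2]⟩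
      linarith
    · rw [intervalIntegral.integral_const, smul_eq_mul]
      ring
  simp only [hL] at key
  refine key.trans ?_
  have := Finset.sum_le_sum fun v (_ : v ∈ Finset.univ) =>
    mul_le_mul_of_nonneg_left (hR v) (hπ.1 v).le
  have h2 : ∑ v, π v * (2 * (r v * (μ (f v) + r v)))
      = 2 * ∑ v, π v * (r v * (μ (f v) + r v)) := by
    rw [Finset.mul_sum]; exact Finset.sum_congr rfl fun v _ => by ring
  linarith

/-- Greedy choice of thresholds. -/
theorem exists_greedy_partition (π : V → ℝ) (f : V → ℝ) {M c : ℝ} (hM : 0 ≤ M) (hc : 0 ≤ c) :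
    ∃ t : ℕ → ℝ, Monotone t ∧ t 0 = 0 ∧ (∀ i, t i ≤ M) ∧
      (∀ i, ∑ v, π v * tent (t i) (t (i + 1)) (f v) ^ 2 ≤ c) ∧
      ∀ i, t (i + 1) = M ∨ ∑ v, π v * tent (t i) (t (i + 1)) (f v) ^ 2 = c := by
  have step : ∀ a : Set.Iic M, ∃ b : Set.Iic M, a ≤ b ∧
      ∑ v, π v * tent a b (f v) ^ 2 ≤ c ∧
      ((b : ℝ) = M ∨ ∑ v, π v * tent a b (f v) ^ 2 = c) := by
    rintro ⟨a, ha⟩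
    -- Either the rest of the range has mass at most c, and the next threshold is M, or mass exactly
    -- c is reached by the intermediate value theorem.
    by_cases h : ∑ v, π v * tent a M (f v) ^ 2 ≤ c
    · exact ⟨⟨M, Set.mem_Iic.2 le_rfl⟩, ha, h, Or.inl rfl⟩
    · have hcont : Continuous fun b => ∑ v, π v * tent a b (f v) ^ 2 := by
        unfold tent; fun_prop
      have h0 : ∑ v, π v * tent a a (f v) ^ 2 = 0 := by simp [tent_self]
      obtain ⟨b, hb, hbc⟩ := intermediate_value_Icc (Set.mem_Iic.1 ha) hcont.continuousOn
        (show c ∈ Set.Icc _ _ from ⟨h0.le.trans hc, (not_le.1 h).le⟩)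
      exact ⟨⟨b, hb.2⟩, hb.1, hbc.le, Or.inr hbc⟩
  choose F hF1 hF2 hF3 using step
  let t : ℕ → Set.Iic M := fun n => F^[n] ⟨0, hM⟩
  have ht : ∀ n, t (n + 1) = F (t n) := fun n => Function.iterate_succ_apply' F n _
  refine ⟨fun n => t n, monotone_nat_of_le_succ fun n => ?_, rfl, fun n => (t n).2, fun n => ?_,
    fun n => ?_⟩
  · simp only [ht]; exact hF1 _
  · simp only [ht]; exact hF2 _
  · simp only [ht]; exact hF3 _

/-- The median is the smallest value of f with at most half of the weight strictly above it. If more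
than half lay strictly below, the next smaller value would qualify too. -/
theorem exists_median (hπ : IsPosDistribution π) (f : V → ℝ) :
    ∃ m, weight π {v | 0 < f v - m} ≤ 1 / 2 ∧ weight π {v | 0 < m - f v} ≤ 1 / 2 := by
  classical
  simp only [sub_pos]
  have hne : (Finset.univ : Finset V).Nonempty := by
    by_contra h
    rw [Finset.not_nonempty_iff_eq_empty] at h
    have := hπ.2
    rw [h] at this
    simp at this
  obtain ⟨w, -, hw⟩ := Finset.exists_max_image Finset.univ f hne
  set S : Finset V := {u | weight π {v | f u < f v} ≤ 1 / 2} with hS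
  have hwS : w ∈ S := by
    have : ({v | f w < f v} : Finset V) = ∅ :=
      Finset.filter_eq_empty_iff.2 fun v _ => not_lt.2 (hw v (Finset.mem_univ v))
    simp [hS, this, weight]
  obtain ⟨u, hu, hmin⟩ := Finset.exists_min_image S f ⟨w, hwS⟩
  refine ⟨f u, (Finset.mem_filter.1 hu).2, ?_⟩
  by_contra! h
  have hne' : ({v | f v < f u} : Finset V).Nonempty := by
    by_contra h'
    rw [Finset.not_nonempty_iff_eq_empty] at h'
    rw [h'] at h
    norm_num [weight] at h
  obtain ⟨x, hx, hmax⟩ := Finset.exists_max_image _ f hne'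
  rw [Finset.mem_filter] at hx
  have hdisj : Disjoint ({v | f x < f v} : Finset V) ({v | f v < f u} : Finset V) := by
    rw [Finset.disjoint_filter]
    intro v _ h1 h2
    exact absurd (hmax v (by simpa using h2)) (not_le.2 h1)
  have h1 : weight π {v | f x < f v} + weight π {v | f v < f u} ≤ 1 := by
    rw [weight, weight, ← Finset.sum_union hdisj, ← hπ.2]
    exact weight_mono hπ (Finset.subset_univ _)
  have hxS : x ∈ S := by
    simp only [hS, Finset.mem_filter, Finset.mem_univ, true_and]
    linarith
  exact absurd (hmin x hxS) (not_le.2 hx.2)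

/-- A centred function may be replaced by a nonnegative one supported on at most half of the
weight. -/
theorem exists_truncation (hπ : IsPosDistribution π) {f : V → ℝ} (h1 : ∑ v, π v * f v ^ 2 = 1)
    (h0 : ∑ v, π v * f v = 0) :
    ∃ h : V → ℝ, (∀ v, 0 ≤ h v) ∧ weight π {v | 0 < h v} ≤ 1 / 2 ∧
      1 / 2 ≤ ∑ v, π v * h v ^ 2 ∧ ∀ u v, |h u - h v| ≤ |f u - f v| := by
  obtain ⟨m, hm1, hm2⟩ := exists_median hπ f
  -- Centring makes the norm of f - m at least 1, so its positive or its negative part carries at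
  -- least one half.
  have hsum : ∑ v, π v * (max (f v - m) 0) ^ 2 + ∑ v, π v * (max (m - f v) 0) ^ 2 = 1 + m ^ 2 := by
    have : ∀ v, π v * (max (f v - m) 0) ^ 2 + π v * (max (m - f v) 0) ^ 2
        = π v * f v ^ 2 - 2 * m * (π v * f v) + m ^ 2 * π v := fun v => by
      rcases le_total (f v) m with h | h
      · rw [max_eq_right (by linarith), max_eq_left (by linarith)]; ring
      · rw [max_eq_left (by linarith), max_eq_right (by linarith)]; ring
    rw [← Finset.sum_add_distrib]
    simp only [this, Finset.sum_add_distrib, Finset.sum_sub_distrib, ← Finset.mul_sum, h0, h1,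
      hπ.2]
    ring
  rcases le_total (1 / 2) (∑ v, π v * (max (f v - m) 0) ^ 2) with h | h
  · refine ⟨fun v => max (f v - m) 0, fun v => le_max_right _ _, ?_, h, fun u v => ?_⟩
    · simpa using hm1
    · refine (abs_max_sub_max_le_abs _ _ _).trans (le_of_eq ?_)
      rw [sub_sub_sub_cancel_right]
  · refine ⟨fun v => max (m - f v) 0, fun v => le_max_right _ _, ?_, ?_, fun u v => ?_⟩
    · simpa using hm2
    · linarith [sq_nonneg m]
    · refine (abs_max_sub_max_le_abs _ _ _).trans (le_of_eq ?_)
      rw [sub_sub_sub_cancel_left, abs_sub_comm]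

end

variable {V : Type*} [Fintype V] [DecidableEq V] {G : SimpleGraph V} {π : V → ℝ}

/-- The core estimate: `hcσ` forces the greedy partition of mass c to end within k steps, and the
resulting tent density is fed into the integrated threshold inequality. -/
theorem expansion_le_of_truncated (hπ : IsPosDistribution π) {k : ℕ} (hk0 : 0 < k)
    (hk : k ≤ Fintype.card V) {f g : V → ℝ} (hf : ∀ v, 0 ≤ f v) (hg : ∀ v, 0 ≤ g v)
    (hsupp : weight π {v | 0 < f v} ≤ 1 / 2) (hN : 1 / 2 ≤ ∑ v, π v * f v ^ 2)
    (h : ∀ u v, LoopAdj G u v → (f u - f v) ^ 2 ≤ g u + g v) {c : ℝ} (hc : 0 < c)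
    (hcσ : ∑ v, π v * g v < c * sigmaStar G π k) :
    expansion G π ≤ 32 * k * (∑ v, π v * g v + √((∑ v, π v * g v) * (k * c))) := by
  set x := ∑ v, π v * g v with hx
  set M := ∑ v, f v with hM
  have hfM : ∀ v, f v ≤ M := fun v =>
    Finset.single_le_sum (f := f) (fun u _ => hf u) (Finset.mem_univ v)
  obtain ⟨t, ht, ht0, htM, hle, hor⟩ := exists_greedy_partition π f
    (Finset.sum_nonneg fun v _ => hf v : 0 ≤ M) hc.le
  have hk' : (0 : ℝ) < k := Nat.cast_pos.2 hk0
  -- Otherwise all k tents have mass exactly c, and Ky Fan's inequality bounds the eigenvalue sum of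
  -- every reweighting by (∑ π g)/c, contradicting `hcσ`.
  have htk : t k = M := by
    by_contra hne
    have heq : ∀ i : Fin k, ∑ v, π v * tent (t i) (t (i + 1)) (f v) ^ 2 = c := fun i => by
      refine (hor i).resolve_left fun h' => hne (le_antisymm (htM k) ?_)
      rw [hM, ← h']
      exact ht i.2
    refine absurd hcσ (not_lt.2 ?_)
    rw [← le_div_iff₀' hc]
    refine sigmaStar_le fun P hP => ?_
    refine (hP.sum_smallEigenvalue_le hπ hk (fun i v => tent (t i) (t (i + 1)) (f v)) ?_ ?_).trans ?_
    · intro i j hij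
      refine Finset.sum_eq_zero fun v _ => ?_
      rw [mul_assoc, tent_mul_tent ht (fun h' => hij (Fin.ext h')), mul_zero]
    · intro i
      rw [heq]
      exact hc
    · simp only [heq]
      rw [← Finset.sum_div]
      refine div_le_div_of_nonneg_right (le_trans ?_ (hP.dirichletForm_le hπ h)) hc.le
      simp only [dirichletForm]
      rw [← Finset.sum_div]
      refine div_le_div_of_nonneg_right ?_ two_pos.le
      rw [Finset.sum_comm]
      refine Finset.sum_le_sum fun u _ => ?_
      rw [Finset.sum_comm]
      refine Finset.sum_le_sum fun v _ => ?_
      rw [← Finset.mul_sum]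
      refine mul_le_mul_of_nonneg_left ?_ (mul_nonneg (hπ.1 u).le (hP.nonneg u v))
      have := sum_tent_sub_sq_le ht k (f u) (f v)
      rwa [Finset.sum_range] at this
  -- Distance to the nearest threshold on [t 0, t k].
  set μ : ℝ → ℝ := fun s => ∑ i ∈ Finset.range k, tent (t i) (t (i + 1)) s with hμ
  have hr : ∀ u v, LoopAdj G u v → f u - f v ≤ √(g u) + √(g v) := fun u v huv => by
    refine le_of_abs_le (abs_le_of_sq_le_sq ?_ (by positivity))
    have h1 := Real.sq_sqrt (hg u)
    have h2 := Real.sq_sqrt (hg v)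
    nlinarith [h u v huv, mul_nonneg (Real.sqrt_nonneg (g u)) (Real.sqrt_nonneg (g v))]
  have key := expansion_mul_integral_le hπ hf (fun v => Real.sqrt_nonneg (g v)) hsupp hr
    (μ := μ) (fun s => Finset.sum_nonneg fun i _ => tent_nonneg _ _ _) fun x y => by
      simp only [hμ]
      rw [← Finset.sum_sub_distrib]
      exact (Finset.abs_sum_le_sum_abs _ _).trans (sum_abs_tent_sub_le ht k x y)
  have hL : 1 / (8 * k) ≤ ∑ v, π v * ∫ s in (0 : ℝ)..f v, μ s := by
    have h1 := Finset.sum_le_sum fun v (_ : v ∈ Finset.univ) => mul_le_mul_of_nonneg_left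
      (le_integral_sum_tent ht ht0 hk0 (hf v) (htk ▸ hfM v)) (hπ.1 v).le
    refine le_trans ?_ h1
    simp only [← mul_div_assoc]
    rw [← Finset.sum_div, div_le_div_iff₀ (by positivity) (by positivity)]
    nlinarith
  -- Cauchy–Schwarz; disjoint supports make ∑ π μ(f)² the total tent mass, at most kc.
  have hR : ∑ v, π v * (√(g v) * (μ (f v) + √(g v))) ≤ x + √(x * (k * c)) := by
    have h1 : ∀ v, π v * (√(g v) * (μ (f v) + √(g v)))
        = π v * g v + (√(π v) * √(g v)) * (√(π v) * μ (f v)) := fun v => by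
      have h1 := Real.mul_self_sqrt (hg v)
      have h2 := Real.mul_self_sqrt (hπ.1 v).le
      linear_combination π v * h1 - √(g v) * μ (f v) * h2
    simp only [h1, Finset.sum_add_distrib]
    refine add_le_add le_rfl (Real.le_sqrt_of_sq_le ?_)
    refine (Finset.sum_mul_sq_le_sq_mul_sq _ _ _).trans ?_
    have h2 : ∑ v, (√(π v) * √(g v)) ^ 2 = x := Finset.sum_congr rfl fun v _ => by
      rw [mul_pow, Real.sq_sqrt (hπ.1 v).le, Real.sq_sqrt (hg v)]
    have h3 : ∑ v, (√(π v) * μ (f v)) ^ 2 ≤ k * c := by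
      have : ∀ v, (√(π v) * μ (f v)) ^ 2
          = ∑ i ∈ Finset.range k, π v * tent (t i) (t (i + 1)) (f v) ^ 2 := fun v => by
        rw [mul_pow, Real.sq_sqrt (hπ.1 v).le, hμ, sum_tent_sq ht, Finset.mul_sum]
      simp only [this]
      rw [Finset.sum_comm]
      refine (Finset.sum_le_sum fun i _ => hle i).trans ?_
      simp
    rw [h2]
    exact mul_le_mul_of_nonneg_left h3
      (Finset.sum_nonneg fun v _ => mul_nonneg (hπ.1 v).le (hg v))
  have h1 := (mul_le_mul_of_nonneg_left hL (expansion_nonneg G hπ)).trans key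
  rw [mul_one_div, div_le_iff₀ (by positivity)] at h1
  nlinarith [mul_le_mul_of_nonneg_right hR hk'.le]

/-- The improved Cheeger inequality for the one-dimensional dual program. -/
theorem expansion_le_gammaOne (hπ : IsPosDistribution π) {k : ℕ} (hk2 : 2 ≤ k)
    (hk : k ≤ Fintype.card V) (hσ : 0 < sigmaStar G π k) :
    expansion G π ≤ 64 * (k * gammaOne G π * √(k / sigmaStar G π k)) := by
  have hcard := hk2.trans hk
  have hk' : (0 : ℝ) < k := Nat.cast_pos.2 (by omega)
  set σ := sigmaStar G π k with hσdef
  have hq : 1 ≤ √(k / σ) := by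
    rw [Real.one_le_sqrt, one_le_div hσ]
    exact sigmaStar_le_card G hπ hk
  set K := 64 * (k * √(k / σ)) with hK
  have hKpos : 0 < K := by positivity
  suffices h : expansion G π / K ≤ gammaOne G π by
    rw [div_le_iff₀ hKpos] at h
    calc _ ≤ _ := h
      _ = _ := by rw [hK]; ring
  refine le_of_forall_gt_imp_ge_of_dense fun y hy => ?_
  obtain ⟨_, ⟨f, g, hfg, rfl⟩, hxy⟩ := exists_lt_of_csInf_lt (nonempty_gammaOne G hπ hcard) hy
  obtain ⟨h, hh0, hsupp, hN, hlip⟩ := exists_truncation hπ hfg.normalized hfg.centered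
  have hx0 : 0 ≤ ∑ v, π v * g v :=
    Finset.sum_nonneg fun v _ => mul_nonneg (hπ.1 v).le (hfg.nonneg v)
  have hy0 : 0 < y := hx0.trans_lt hxy
  -- The choice c = y/σ, with y strictly above the cost, keeps c positive and `hcσ` strict even if
  -- the cost vanishes.
  have key := expansion_le_of_truncated hπ (by omega) hk hh0 hfg.nonneg hsupp hN
    (fun u v huv => (sq_le_sq.2 (hlip u v)).trans (hfg.edge u v huv)) (div_pos hy0 hσ)
    (by rwa [← hσdef, div_mul_cancel₀ _ hσ.ne'])
  rw [div_le_iff₀ hKpos]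
  refine key.trans ?_
  have h1 : √((∑ v, π v * g v) * (k * (y / σ))) ≤ y * √(k / σ) := by
    rw [Real.sqrt_le_left (by positivity), mul_pow, Real.sq_sqrt (by positivity)]
    have : (k : ℝ) * (y / σ) = y * (k / σ) := by ring
    rw [this, ← mul_assoc, sq]
    exact mul_le_mul_of_nonneg_right (mul_le_mul_of_nonneg_right hxy.le hy0.le) (by positivity)
  have h2 : y ≤ y * √(k / σ) := le_mul_of_one_le_right hy0.le hq
  rw [hK]
  nlinarith

end VertexExpansion

/-! ### Duality for the second eigenvalue and random projection to the line -/

namespace VertexExpansion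

/-- The sign `±1` encoded by a Boolean. -/
def boolSign (b : Bool) : ℝ := if b then 1 else -1

theorem sum_boolSign_mul_boolSign {ι : Type*} [Fintype ι] [DecidableEq ι] {i j : ι} (hij : i ≠ j) :
    ∑ ξ : ι → Bool, boolSign (ξ i) * boolSign (ξ j) = 0 := by
  have h := Finset.prod_univ_sum (fun _ : ι => (Finset.univ : Finset Bool))
    (fun l b => (if l = i then boolSign b else 1) * (if l = j then boolSign b else 1))
  rw [Fintype.piFinset_univ] at h
  simp only [Finset.prod_mul_distrib, Finset.prod_ite_eq', Finset.mem_univ, if_true] at h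
  rw [← h]
  refine Finset.prod_eq_zero (Finset.mem_univ i) ?_
  simp [hij, boolSign]

theorem sum_sq_sum_boolSign {ι : Type*} [Fintype ι] [DecidableEq ι] (a : ι → ℝ) :
    ∑ ξ : ι → Bool, (∑ i, boolSign (ξ i) * a i) ^ 2
      = Fintype.card (ι → Bool) * ∑ i, a i ^ 2 := by
  have h1 : ∀ ξ : ι → Bool, (∑ i, boolSign (ξ i) * a i) ^ 2
      = ∑ i, ∑ j, a i * a j * (boolSign (ξ i) * boolSign (ξ j)) := fun ξ => by
    rw [sq, Finset.sum_mul_sum]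
    exact Finset.sum_congr rfl fun i _ => Finset.sum_congr rfl fun j _ => by ring
  simp only [h1]
  rw [Finset.sum_comm, Finset.mul_sum]
  refine Finset.sum_congr rfl fun i _ => ?_
  rw [Finset.sum_comm, Finset.sum_eq_single i]
  · have : ∀ b, boolSign b * boolSign b = 1 := fun b => by cases b <;> simp [boolSign]
    simp only [this]
    simp
    ring
  · intro j _ hj
    rw [← Finset.mul_sum, sum_boolSign_mul_boolSign hj.symm, mul_zero]
  · intro h
    exact absurd (Finset.mem_univ i) h

/-- Random signs are subgaussian. -/
theorem sum_exp_sum_boolSign_le {ι : Type*} [Fintype ι] [DecidableEq ι] (a : ι → ℝ) :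
    ∑ ξ : ι → Bool, Real.exp (∑ i, boolSign (ξ i) * a i)
      ≤ Fintype.card (ι → Bool) * Real.exp ((∑ i, a i ^ 2) / 2) := by
  have h := Finset.prod_univ_sum (fun _ : ι => (Finset.univ : Finset Bool))
    (fun i b => Real.exp (boolSign b * a i))
  rw [Fintype.piFinset_univ] at h
  simp only [Real.exp_sum]
  rw [← h, Finset.sum_div, Real.exp_sum, Fintype.card_fun, Fintype.card_bool, Nat.cast_pow,
    ← Finset.card_univ, ← Finset.prod_const, ← Finset.prod_mul_distrib]
  refine Finset.prod_le_prod (fun i _ => Finset.sum_nonneg fun b _ => (Real.exp_pos _).le)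
    fun i _ => ?_
  have := Real.cosh_le_exp_half_sq (a i)
  rw [Real.cosh_eq] at this
  simp [boolSign]
  linarith

/-- For y ≥ L ≥ 2 the bound 1 + x ≤ exp x at x = (y - L)/2 gives y ≤ L exp((y - L)/2). It stands in
for a tail bound: squares beyond L² are paid for by exponential moments. -/
theorem sq_le_sq_mul_one_add_exp {L y : ℝ} (hL : 2 ≤ L) :
    y ^ 2 ≤ L ^ 2 * (1 + Real.exp (-L) * (Real.exp y + Real.exp (-y))) := by
  wlog hy : 0 ≤ y generalizing y
  · have := this (y := -y) (by linarith)
    rw [neg_sq, neg_neg] at this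
    rwa [add_comm (Real.exp y)]
  have h0 : 0 ≤ Real.exp (-L) * Real.exp (-y) := by positivity
  have h1 : y ≤ L * Real.exp ((y - L) / 2) ∨ y ≤ L := by
    rcases le_total y L with h | h
    · exact Or.inr h
    · left
      nlinarith [Real.add_one_le_exp ((y - L) / 2)]
  have h2 : Real.exp ((y - L) / 2) ^ 2 = Real.exp (-L) * Real.exp y := by
    rw [← Real.exp_nat_mul, ← Real.exp_add]
    congr 1
    push_cast
    ring
  have h3 : 0 ≤ Real.exp (-L) * Real.exp y := by positivity
  rcases h1 with h1 | h1
  · have := pow_le_pow_left₀ hy h1 2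
    rw [mul_pow, h2] at this
    nlinarith [sq_nonneg L, mul_nonneg (sq_nonneg L) h0]
  · have := pow_le_pow_left₀ hy h1 2
    nlinarith [mul_nonneg (sq_nonneg L) h0, mul_nonneg (sq_nonneg L) h3]

theorem nonpos_of_forall_add_mul_lt {A B c : ℝ} (h : ∀ r : ℝ, 0 ≤ r → A + r * B < c) : B ≤ 0 := by
  by_contra! hB
  have := h (|c - A| / B) (by positivity)
  rw [div_mul_cancel₀ _ hB.ne'] at this
  linarith [le_abs_self (c - A)]

theorem le_of_forall_add_mul_lt {A B c : ℝ} (h : ∀ r : ℝ, 0 < r → A + r * B < c) : A ≤ c := by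
  by_contra! hA
  have := h ((A - c) / (|B| + 1)) (div_pos (by linarith) (by positivity))
  have h1 : (A - c) / (|B| + 1) * (|B| + 1) = A - c := div_mul_cancel₀ _ (by positivity)
  have h2 : 0 < (A - c) / (|B| + 1) := div_pos (by linarith) (by positivity)
  nlinarith [neg_abs_le B]

/-- The squared distance functions of the centred normalized functions on `V`. -/
def distanceFunctions {V : Type*} [Fintype V] (π : V → ℝ) : Set (V → V → ℝ) :=
  {d | ∃ f : V → ℝ, ∑ v, π v * f v ^ 2 = 1 ∧ ∑ v, π v * f v = 0 ∧
    d = fun u v => (f u - f v) ^ 2}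

variable {V : Type*} [Fintype V] [DecidableEq V] {G : SimpleGraph V} {π : V → ℝ}

theorem distanceFunctions_nonempty {V : Type*} [Fintype V] {π : V → ℝ}
    (hπ : IsPosDistribution π) (hcard : 2 ≤ Fintype.card V) :
    (distanceFunctions π).Nonempty := by
  obtain ⟨_, f, g, h, -⟩ := nonempty_gammaOne (⊥ : SimpleGraph V) hπ hcard
  exact ⟨_, f, h.normalized, h.centered, rfl⟩

/-- A nonnegative weighting of the edges whose marginals are proportional to `π` and which is
large on all distance functions yields a reweighting with large second eigenvalue. -/
theorem le_lambdaStar_two_of_multipliers (hπ : IsPosDistribution π) (hcard : 2 ≤ Fintype.card V)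
    {Q : V → V → ℝ} {θ s : ℝ} (hθ : 0 < θ) (hQ0 : ∀ u v, 0 ≤ Q u v)
    (hQs : ∀ u v, ¬ LoopAdj G u v → Q u v = 0)
    (hrow : ∀ u, ∑ v, Q u v + ∑ v, Q v u = θ * π u)
    (hd : ∀ d ∈ distanceFunctions π, θ * s ≤ ∑ u, ∑ v, Q u v * d u v) :
    s ≤ lambdaStar G π 2 := by
  have hθπ : ∀ u, θ * π u ≠ 0 := fun u => (mul_pos hθ (hπ.1 u)).ne'
  have hmul : ∀ u v, π u * ((Q u v + Q v u) / (θ * π u)) = (Q u v + Q v u) / θ := fun u v => by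
    have := hθπ u
    have := (hπ.1 u).ne'
    field_simp
  have hP : IsReweighting G π (Matrix.of fun u v => (Q u v + Q v u) / (θ * π u)) := by
    refine ⟨fun u v => ?_, fun u v h => ?_, fun u => ?_, fun u v _ => ?_⟩
    · exact div_nonneg (add_nonneg (hQ0 _ _) (hQ0 _ _)) (mul_pos hθ (hπ.1 u)).le
    · simp [hQs u v h, hQs v u fun h' => h h'.symm]
    · simp only [Matrix.of_apply]
      rw [← Finset.sum_div, Finset.sum_add_distrib, hrow, div_self (hθπ u)]
    · simp only [Matrix.of_apply]
      rw [hmul, hmul, add_comm]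
  refine (hP.le_smallEigenvalue_two hπ hcard fun f hf1 hf0 => ?_).trans
    (hP.le_lambdaStar hπ one_le_two hcard)
  have h := hd _ ⟨f, hf1, hf0, rfl⟩
  have h2 : ∑ u, ∑ v, Q v u * (f u - f v) ^ 2 = ∑ u, ∑ v, Q u v * (f u - f v) ^ 2 := by
    rw [Finset.sum_comm]
    exact Finset.sum_congr rfl fun u _ => Finset.sum_congr rfl fun v _ => by ring
  simp only [dirichletForm, Matrix.of_apply, hmul]
  have h3 : ∑ u, ∑ v, (Q u v + Q v u) / θ * (f u - f v) ^ 2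
      = (2 * ∑ u, ∑ v, Q u v * (f u - f v) ^ 2) / θ := by
    rw [two_mul]
    nth_rewrite 2 [← h2]
    simp only [← Finset.sum_add_distrib, Finset.sum_div]
    exact Finset.sum_congr rfl fun u _ => Finset.sum_congr rfl fun v _ => by ring
  rw [h3, le_div_iff₀ two_pos, le_div_iff₀ hθ]
  linarith

theorem isOpen_strict_constraints {V : Type*} [Fintype V] (G : SimpleGraph V) (s : ℝ) :
    IsOpen {p : (V → V → ℝ) × ℝ | (∀ u v, LoopAdj G u v → 0 < p.1 u v) ∧ p.2 < s} := by
  have h : {p : (V → V → ℝ) × ℝ | (∀ u v, LoopAdj G u v → 0 < p.1 u v) ∧ p.2 < s}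
      = (⋂ u, ⋂ v, ⋂ (_ : LoopAdj G u v), {p | 0 < p.1 u v}) ∩ {p | p.2 < s} := by
    ext
    simp
  rw [h]
  refine IsOpen.inter ?_ (isOpen_lt continuous_snd continuous_const)
  refine isOpen_iInter_of_finite fun u => isOpen_iInter_of_finite fun v =>
    isOpen_iInter_of_finite fun _ => isOpen_lt continuous_const ?_
  exact (continuous_apply v).comp ((continuous_apply u).comp continuous_fst)

theorem convex_strict_constraints {V : Type*} (G : SimpleGraph V) (s : ℝ) :
    Convex ℝ {p : (V → V → ℝ) × ℝ | (∀ u v, LoopAdj G u v → 0 < p.1 u v) ∧ p.2 < s} := by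
  refine convex_iff_forall_pos.2 ?_
  rintro ⟨z, t⟩ ⟨hz, ht⟩ ⟨z', t'⟩ ⟨hz', ht'⟩ a b ha hb hab
  refine ⟨fun u v h => ?_, ?_⟩
  · have h1 := mul_pos ha (hz u v h)
    have h2 := mul_pos hb (hz' u v h)
    exact add_pos h1 h2
  · have h1 := mul_lt_mul_of_pos_left ht ha
    have h2 := mul_lt_mul_of_pos_left ht' hb
    have h3 : a * s + b * s = s := by rw [← add_mul, hab, one_mul]
    change a * t + b * t' < s
    simp only at h1 h2
    linarith

theorem convex_slacks {V : Type*} [Fintype V] (π : V → ℝ) :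
    Convex ℝ {p : (V → V → ℝ) × ℝ | ∃ d ∈ convexHull ℝ (distanceFunctions π), ∃ g : V → ℝ,
      p = (fun u v => g u + g v - d u v, ∑ v, π v * g v)} := by
  rintro _ ⟨d, hd, g, rfl⟩ _ ⟨d', hd', g', rfl⟩ a b ha hb hab
  refine ⟨a • d + b • d', convex_convexHull ℝ _ hd hd' ha hb hab, a • g + b • g', ?_⟩
  refine Prod.ext ?_ ?_
  · ext u v
    simp only [Prod.smul_mk, Prod.mk_add_mk, Pi.add_apply, Pi.smul_apply, smul_eq_mul]
    ring
  · simp only [Prod.smul_mk, Prod.mk_add_mk, Pi.add_apply, Pi.smul_apply, smul_eq_mul,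
      Finset.mul_sum, ← Finset.sum_add_distrib]
    exact Finset.sum_congr rfl fun v _ => by ring

theorem linear_apply_eq_sum (φ : ((V → V → ℝ) × ℝ) →ₗ[ℝ] ℝ) (z : V → V → ℝ) (t : ℝ) :
    φ (z, t) = φ (0, 1) * t + ∑ u, ∑ v, φ (Pi.single u (Pi.single v 1), 0) * z u v := by
  have h1 : (z, t) = t • ((0 : V → V → ℝ), (1 : ℝ))
      + ∑ u, ∑ v, z u v • ((Pi.single u (Pi.single v 1) : V → V → ℝ), (0 : ℝ)) := by
    refine Prod.ext ?_ ?_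
    · ext x y
      simp [Prod.fst_sum, Finset.sum_apply, Pi.single_apply, apply_ite]
    · simp [Prod.snd_sum]
  conv_lhs => rw [h1]
  simp only [map_add, map_sum, map_smul, smul_eq_mul]
  congr 1
  · ring
  · exact Finset.sum_congr rfl fun u _ => Finset.sum_congr rfl fun v _ => by ring

/-- Weak form of strong duality for the maximum reweighted second eigenvalue. -/
theorem exists_convexHull_of_lambdaStar_lt (hπ : IsPosDistribution π)
    (hcard : 2 ≤ Fintype.card V) {s : ℝ} (hs : lambdaStar G π 2 < s) :
    ∃ d ∈ convexHull ℝ (distanceFunctions π), ∃ g : V → ℝ, (∀ v, 0 < g v) ∧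
      (∀ u v, LoopAdj G u v → d u v ≤ g u + g v) ∧ ∑ v, π v * g v < s := by
  by_contra hno
  refine absurd hs (not_lt.2 ?_)
  have hdisj : Disjoint {p : (V → V → ℝ) × ℝ | (∀ u v, LoopAdj G u v → 0 < p.1 u v) ∧ p.2 < s}
      {p : (V → V → ℝ) × ℝ | ∃ d ∈ convexHull ℝ (distanceFunctions π), ∃ g : V → ℝ,
        p = (fun u v => g u + g v - d u v, ∑ v, π v * g v)} := by
    rw [Set.disjoint_left]
    rintro _ ⟨hz, ht⟩ ⟨d, hd, g, rfl⟩
    have hd0 : ∀ v, d v v = 0 := fun v => by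
      have hsub : convexHull ℝ (distanceFunctions π) ⊆ {d | d v v = 0} := by
        refine convexHull_min ?_ ?_
        · rintro _ ⟨f, -, -, rfl⟩
          simp
        · intro x hx y hy a b _ _ _
          simp only [Set.mem_ofPred_eq] at hx hy ⊢
          simp [hx, hy]
      exact hsub hd
    refine hno ⟨d, hd, g, fun v => ?_, fun u v h => ?_, ht⟩
    -- Since d vanishes on the diagonal, the self-loop constraint reads 2 g(v) > 0. Positivity of g
    -- therefore need not be imposed separately.
    · have := hz v v (Or.inl rfl)
      simp only [hd0] at this
      linarith
    · have := hz u v h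
      simp only at this
      linarith
  obtain ⟨φ, c, hO, hC⟩ := geometric_hahn_banach_open (convex_strict_constraints G s)
    (isOpen_strict_constraints G s) (convex_slacks π) hdisj
  set θ := φ (0, 1) with hθ
  set Q : V → V → ℝ := fun u v => -φ (Pi.single u (Pi.single v 1), 0) with hQ
  have hφ : ∀ z t, φ (z, t) = θ * t - ∑ u, ∑ v, Q u v * z u v := fun z t => by
    have := linear_apply_eq_sum (φ : ((V → V → ℝ) × ℝ) →ₗ[ℝ] ℝ) z t
    simp only [ContinuousLinearMap.coe_coe] at this
    rw [this]
    simp [hQ, hθ]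
  -- A functional bounded above on the open set is nonpositive on its recession directions. This
  -- gives the sign of Q, its support and the sign of θ.
  have hdir : ∀ z t, (∀ u v, LoopAdj G u v → 0 ≤ z u v) → t ≤ 0 → φ (z, t) ≤ 0 := by
    intro z t hz ht
    refine nonpos_of_forall_add_mul_lt (A := φ ((fun _ _ => 1), s - 1)) (c := c) fun r hr => ?_
    rw [← smul_eq_mul, ← map_smul, ← map_add]
    refine hO _ ⟨fun u v h => ?_, ?_⟩
    · have := mul_nonneg hr (hz u v h)
      simp only [Prod.smul_mk, Prod.mk_add_mk, Pi.add_apply, Pi.smul_apply, smul_eq_mul]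
      linarith
    · have := mul_nonpos_of_nonneg_of_nonpos hr ht
      simp only [Prod.smul_mk, Prod.mk_add_mk, smul_eq_mul]
      linarith
  have hQ0 : ∀ u v, 0 ≤ Q u v := fun u v => by
    have := hdir (Pi.single u (Pi.single v 1)) 0 (fun x y _ => by
      rw [Pi.single_apply]
      split_ifs
      · rw [Pi.single_apply]
        split_ifs <;> norm_num
      · simp) le_rfl
    simp only [hQ]
    linarith
  have hQs : ∀ u v, ¬ LoopAdj G u v → Q u v = 0 := fun u v huv => by
    refine le_antisymm ?_ (hQ0 u v)
    have := hdir (-Pi.single u (Pi.single v 1)) 0 (fun x y hxy => by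
      rw [Pi.neg_apply, Pi.neg_apply, Pi.single_apply]
      split_ifs with h1
      · rw [Pi.single_apply]
        split_ifs with h2
        · subst h1 h2
          exact absurd hxy huv
        · simp
      · simp) le_rfl
    have h2 : ((-Pi.single u (Pi.single v 1) : V → V → ℝ), (0 : ℝ))
        = -((Pi.single u (Pi.single v 1) : V → V → ℝ), (0 : ℝ)) := by simp
    rw [h2, map_neg] at this
    exact this
  have hθ0 : 0 ≤ θ := by
    have := hdir 0 (-1) (fun _ _ _ => le_rfl) (by norm_num)
    rw [hφ] at this
    simp at this
    exact this
  have hcs : θ * s ≤ c := by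
    have := le_of_forall_add_mul_lt (A := φ (0, s)) (B := φ ((fun _ _ => 1), -1)) (c := c)
      fun r hr => by
        rw [← smul_eq_mul, ← map_smul, ← map_add]
        refine hO _ ⟨fun u v h => ?_, ?_⟩
        · simpa using hr
        · simpa using hr
    rw [hφ] at this
    simpa using this
  have hCg : ∀ d ∈ convexHull ℝ (distanceFunctions π), ∀ g : V → ℝ,
      c ≤ θ * (∑ v, π v * g v) - ∑ u, ∑ v, Q u v * (g u + g v - d u v) := fun d hd g => by
    have := hC _ ⟨d, hd, g, rfl⟩
    rwa [hφ] at this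
  obtain ⟨d₀, hd₀'⟩ := distanceFunctions_nonempty hπ hcard
  have hd₀ := subset_convexHull ℝ _ hd₀'
  -- Because g is unrestricted in sign, the separating inequality bounds a linear function of r ∈ ℝ,
  -- whose slope must vanish.
  have hrow : ∀ x, ∑ v, Q x v + ∑ v, Q v x = θ * π x := by
    intro x
    set B := ∑ v, Q x v + ∑ v, Q v x - θ * π x with hB
    have hlin : ∀ r : ℝ, r * B ≤ ∑ u, ∑ v, Q u v * d₀ u v - c := fun r => by
      have := hCg d₀ hd₀ (Pi.single x r)
      have h1 : ∑ v, π v * (Pi.single x r : V → ℝ) v = π x * r := by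
        simp [Pi.single_apply]
      have h2 : ∑ u, ∑ v, Q u v * ((Pi.single x r : V → ℝ) u + (Pi.single x r : V → ℝ) v - d₀ u v)
          = r * ∑ v, Q x v + r * ∑ v, Q v x - ∑ u, ∑ v, Q u v * d₀ u v := by
        simp only [mul_sub, mul_add, Finset.sum_sub_distrib, Finset.sum_add_distrib]
        congr 2
        · rw [Finset.sum_comm]
          simp [Pi.single_apply, Finset.mul_sum, mul_comm]
        · simp [Pi.single_apply, Finset.mul_sum, mul_comm]
      rw [h1, h2] at this
      rw [hB]
      linarith
    have h1 : B ≤ 0 := nonpos_of_forall_add_mul_lt (A := 0)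
      (c := ∑ u, ∑ v, Q u v * d₀ u v - c + 1) fun r _ => by linarith [hlin r]
    have h2 : -B ≤ 0 := nonpos_of_forall_add_mul_lt (A := 0)
      (c := ∑ u, ∑ v, Q u v * d₀ u v - c + 1) fun r _ => by linarith [hlin (-r)]
    linarith
  -- If θ = 0, the marginals force Q = 0, so φ = 0, which contradicts strict separation.
  have hθpos : 0 < θ := by
    refine hθ0.lt_of_ne' fun h0 => ?_
    have hQz : ∀ u v, Q u v = 0 := fun u v => by
      have h1 := hrow u
      rw [h0, zero_mul] at h1
      have h2 := Finset.single_le_sum (f := fun v => Q u v) (fun v _ => hQ0 u v)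
        (Finset.mem_univ v)
      have h3 := Finset.sum_nonneg fun v (_ : v ∈ Finset.univ) => hQ0 v u
      linarith [hQ0 u v]
    have hφ0 : ∀ p, φ p = 0 := fun ⟨z, t⟩ => by simp [hφ, h0, hQz]
    have h1 := hO ((fun _ _ => 1), s - 1) ⟨fun _ _ _ => one_pos, by simp⟩
    have h2 := hC _ ⟨d₀, hd₀, 0, rfl⟩
    rw [hφ0] at h1 h2
    linarith
  refine le_lambdaStar_two_of_multipliers hπ hcard hθpos hQ0 hQs hrow fun d hd => ?_
  have := hCg d (subset_convexHull ℝ _ hd) 0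
  simp at this
  linarith

theorem card_filter_loopAdj_le_maxDeg {V : Type*} [Fintype V] (G : SimpleGraph V) (v : V) (p : V → Prop)
    [DecidablePred fun u => LoopAdj G v u ∧ p u] :
    (Finset.univ.filter fun u => LoopAdj G v u ∧ p u).card ≤ maxDeg G := by
  refine le_trans ?_ (Finset.le_sup (f := loopDegree G) (Finset.mem_univ v))
  rw [loopDegree, ← Set.ncard_coe_finset]
  exact Set.ncard_le_ncard (fun u hu => by simp at hu; exact hu.1) (Set.toFinite _)

/-- Projecting a convex combination of distance functions to the line by random signs. -/
theorem gammaOne_le_of_convexHull {V : Type*} [Fintype V] {G : SimpleGraph V} {π : V → ℝ}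
    (hπ : IsPosDistribution π) (hD : 2 ≤ maxDeg G)
    {d : V → V → ℝ} (hd : d ∈ convexHull ℝ (distanceFunctions π)) {g : V → ℝ} (hg : ∀ v, 0 < g v)
    (hdg : ∀ u v, LoopAdj G u v → d u v ≤ g u + g v) {s : ℝ} (hs : ∑ v, π v * g v < s) :
    gammaOne G π ≤ 8 * (Real.log (maxDeg G) + 1) ^ 2 / Real.log (maxDeg G) * s := by
  classical
  rw [mem_convexHull_iff_exists_fintype] at hd
  obtain ⟨ι, _, w, z, hw0, hw1, hz, hdz⟩ := hd
  choose f hf1 hf0 hfz using hz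
  set D : ℝ := (maxDeg G : ℝ) with hDdef
  have hD2 : (2 : ℝ) ≤ D := by rw [hDdef]; exact_mod_cast hD
  set ℓ := Real.log D with hℓ
  have hℓ0 : 0 < ℓ := Real.log_pos (by linarith)
  have hexpℓ : Real.exp ℓ = D := Real.exp_log (by linarith)
  -- Chosen so that exp(-L) absorbs D neighbours, an exponential moment of at most D, and the factor
  -- 2 for the two signs.
  set L := 2 * ℓ + 2 with hL
  have hL2 : 2 ≤ L := by linarith
  set N : ℝ := ((Fintype.card (ι → Bool) : ℕ) : ℝ) with hN
  have hNpos : 0 < N := Nat.cast_pos.2 Fintype.card_pos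
  -- On average over ξ, (F ξ u - F ξ v)² equals d(u, v).
  let F : (ι → Bool) → V → ℝ := fun ξ v => ∑ i, boolSign (ξ i) * (√(w i) * f i v)
  -- If g(u) ≤ g(v), then d(u, v) ≤ 2 g(v), so the scaled difference has variance at most 2ℓ and
  -- exponential moment at most exp ℓ = D.
  let σ : V → ℝ := fun v => √(ℓ / g v)
  have hσ : ∀ v, σ v ^ 2 = ℓ / g v := fun v => Real.sq_sqrt (div_pos hℓ0 (hg v)).le
  -- Each edge is charged only to its endpoint with the larger g. The sum over neighbours replaces a
  -- maximum.
  let H : (ι → Bool) → V → ℝ := fun ξ v =>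
    L ^ 2 / ℓ * g v * (1 + ∑ u with LoopAdj G v u ∧ g u ≤ g v, Real.exp (-L) *
      (Real.exp (σ v * (F ξ u - F ξ v)) + Real.exp (-(σ v * (F ξ u - F ξ v)))))
  have hH0 : ∀ ξ v, 0 ≤ H ξ v := fun ξ v => by
    have := hg v
    simp only [H]
    positivity
  have hedge' : ∀ ξ u v, LoopAdj G u v → g u ≤ g v → (F ξ u - F ξ v) ^ 2 ≤ H ξ v := by
    intro ξ u v huv hguv
    have h1 := sq_le_sq_mul_one_add_exp (L := L) (y := σ v * (F ξ u - F ξ v)) hL2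
    have h2 := Finset.single_le_sum
      (s := Finset.univ.filter fun u => LoopAdj G v u ∧ g u ≤ g v)
      (f := fun u => Real.exp (-L) * (Real.exp (σ v * (F ξ u - F ξ v))
        + Real.exp (-(σ v * (F ξ u - F ξ v))))) (fun u _ => by positivity)
      (Finset.mem_filter.2 ⟨Finset.mem_univ u, huv.symm, hguv⟩)
    have h3 : (F ξ u - F ξ v) ^ 2 = g v / ℓ * (σ v * (F ξ u - F ξ v)) ^ 2 := by
      have := (hg v).ne'
      have := hℓ0.ne'
      rw [mul_pow, hσ]
      field_simp
    have h4 : 0 ≤ g v / ℓ := (div_pos (hg v) hℓ0).le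
    rw [h3]
    refine (mul_le_mul_of_nonneg_left h1 h4).trans ?_
    simp only [H]
    rw [show L ^ 2 / ℓ * g v = g v / ℓ * L ^ 2 by ring, mul_assoc (g v / ℓ)]
    refine mul_le_mul_of_nonneg_left (mul_le_mul_of_nonneg_left ?_ (sq_nonneg L)) h4
    linarith
  have hedge : ∀ ξ u v, LoopAdj G u v → (F ξ u - F ξ v) ^ 2 ≤ H ξ u + H ξ v := by
    intro ξ u v huv
    rcases le_total (g u) (g v) with h | h
    · linarith [hedge' ξ u v huv h, hH0 ξ u]
    · have := hedge' ξ v u huv.symm h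
      rw [← neg_sub, neg_sq] at this
      linarith [hH0 ξ v]
  have hcent : ∀ ξ, ∑ v, π v * F ξ v = 0 := by
    intro ξ
    simp only [F, Finset.mul_sum]
    rw [Finset.sum_comm]
    refine Finset.sum_eq_zero fun i _ => ?_
    have : ∀ v, π v * (boolSign (ξ i) * (√(w i) * f i v))
        = boolSign (ξ i) * √(w i) * (π v * f i v) := fun v => by ring
    simp only [this, ← Finset.mul_sum, hf0, mul_zero]
  have hvar : ∑ ξ, ∑ v, π v * F ξ v ^ 2 = N := by
    rw [Finset.sum_comm]
    have h1 : ∀ v, ∑ ξ, π v * F ξ v ^ 2 = N * ∑ i, w i * (π v * f i v ^ 2) := fun v => by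
      rw [← Finset.mul_sum, sum_sq_sum_boolSign, ← hN, Finset.mul_sum, Finset.mul_sum,
        Finset.mul_sum]
      refine Finset.sum_congr rfl fun i _ => ?_
      rw [mul_pow, Real.sq_sqrt (hw0 i)]
      ring
    simp only [h1, ← Finset.mul_sum]
    rw [Finset.sum_comm]
    simp only [← Finset.mul_sum, hf1, mul_one, hw1]
  have hmgf : ∀ u v, LoopAdj G v u → g u ≤ g v →
      ∑ ξ, Real.exp (-L) * (Real.exp (σ v * (F ξ u - F ξ v))
        + Real.exp (-(σ v * (F ξ u - F ξ v)))) ≤ Real.exp (-L) * (2 * (N * D)) := by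
    intro u v huv hguv
    have hbase : ∀ ε : ℝ, ε ^ 2 = 1 →
        ∑ ξ, Real.exp (ε * (σ v * (F ξ u - F ξ v))) ≤ N * D := by
      intro ε hε
      have h1 : ∀ ξ, ε * (σ v * (F ξ u - F ξ v))
          = ∑ i, boolSign (ξ i) * (ε * σ v * √(w i) * (f i u - f i v)) := fun ξ => by
        simp only [F, ← Finset.sum_sub_distrib, Finset.mul_sum]
        exact Finset.sum_congr rfl fun i _ => by ring
      simp only [h1]
      refine (sum_exp_sum_boolSign_le _).trans ?_
      rw [← hN]
      refine mul_le_mul_of_nonneg_left ?_ hNpos.le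
      rw [← hexpℓ]
      refine Real.exp_le_exp.2 ?_
      have h2 : ∑ i, (ε * σ v * √(w i) * (f i u - f i v)) ^ 2 = ℓ / g v * d u v := by
        rw [← hdz]
        simp only [hfz, Finset.sum_apply, Pi.smul_apply, smul_eq_mul, Finset.mul_sum]
        refine Finset.sum_congr rfl fun i _ => ?_
        rw [mul_pow, mul_pow, mul_pow, hε, hσ, Real.sq_sqrt (hw0 i)]
        ring
      have h3 := hdg u v huv.symm
      rw [h2, div_mul_eq_mul_div, div_div, div_le_iff₀ (by linarith [hg v])]
      nlinarith
    have ha := hbase 1 (by norm_num)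
    have hb := hbase (-1) (by norm_num)
    simp only [one_mul, neg_one_mul] at ha hb
    rw [← Finset.mul_sum, Finset.sum_add_distrib]
    exact mul_le_mul_of_nonneg_left (by linarith) (Real.exp_pos _).le
  have hexpL : D * (Real.exp (-L) * (2 * (N * D))) ≤ N := by
    have h1 : Real.exp (-L) * (D * D) = Real.exp (-2) := by
      rw [← hexpℓ, ← Real.exp_add, ← Real.exp_add]
      congr 1
      rw [hL]
      ring
    have h2 : Real.exp (-2) ≤ 1 / 2 := by
      rw [Real.exp_neg, ← one_div]
      exact one_div_le_one_div_of_le two_pos (by linarith [Real.add_one_le_exp (2 : ℝ)])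
    calc D * (Real.exp (-L) * (2 * (N * D))) = Real.exp (-L) * (D * D) * (2 * N) := by ring
      _ ≤ 1 / 2 * (2 * N) := by rw [h1]; exact mul_le_mul_of_nonneg_right h2 (by linarith)
      _ = N := by ring
  have hHsum : ∀ v, ∑ ξ, H ξ v ≤ L ^ 2 / ℓ * g v * (2 * N) := by
    intro v
    simp only [H]
    rw [← Finset.mul_sum]
    refine mul_le_mul_of_nonneg_left ?_ (by have := hg v; positivity)
    rw [Finset.sum_add_distrib, Finset.sum_comm]
    have h1 : ∑ _ξ : ι → Bool, (1 : ℝ) = N := by simp [hN]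
    have h2 := Finset.sum_le_card_nsmul
      (Finset.univ.filter fun u => LoopAdj G v u ∧ g u ≤ g v) _ _
      fun u hu => hmgf u v (Finset.mem_filter.1 hu).2.1 (Finset.mem_filter.1 hu).2.2
    rw [nsmul_eq_mul] at h2
    have h3 : ((Finset.univ.filter fun u => LoopAdj G v u ∧ g u ≤ g v).card : ℝ) ≤ D := by
      rw [hDdef]
      exact_mod_cast card_filter_loopAdj_le_maxDeg G v fun u => g u ≤ g v
    have h4 := mul_le_mul_of_nonneg_right h3
      (by positivity : 0 ≤ Real.exp (-L) * (2 * (N * D)))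
    rw [h1]
    linarith
  set K := 8 * (ℓ + 1) ^ 2 / ℓ with hK
  have hKL : L ^ 2 / ℓ * 2 = K := by rw [hL, hK]; ring
  have hKpos : 0 < K := by positivity
  have hs0 : 0 < s := (Finset.sum_nonneg fun v _ => (mul_pos (hπ.1 v) (hg v)).le).trans_lt hs
  -- Cost and variance are compared in one averaged inequality. A single ξ then has a good ratio,
  -- with no separate control of the random variance.
  have hcomp : ∑ ξ, ∑ v, π v * H ξ v < ∑ ξ, K * s * ∑ v, π v * F ξ v ^ 2 := by
    rw [← Finset.mul_sum, hvar, Finset.sum_comm]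
    calc ∑ v, ∑ ξ, π v * H ξ v ≤ ∑ v, K * N * (π v * g v) := by
          refine Finset.sum_le_sum fun v _ => ?_
          rw [← Finset.mul_sum]
          refine (mul_le_mul_of_nonneg_left (hHsum v) (hπ.1 v).le).trans (le_of_eq ?_)
          rw [← hKL]
          ring
      _ = K * N * ∑ v, π v * g v := by rw [Finset.mul_sum]
      _ < K * N * s := mul_lt_mul_of_pos_left hs (by positivity)
      _ = K * s * N := by ring
  obtain ⟨ξ, -, hξ⟩ := Finset.exists_lt_of_sum_lt hcomp
  have hA : 0 ≤ ∑ v, π v * H ξ v := Finset.sum_nonneg fun v _ => mul_nonneg (hπ.1 v).le (hH0 ξ v)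
  have hY : 0 < ∑ v, π v * F ξ v ^ 2 :=
    pos_of_mul_pos_right (hA.trans_lt hξ) (by positivity)
  have := (gammaOne_mul_le hπ (hH0 ξ) (hcent ξ) hY (hedge ξ)).trans hξ.le
  exact le_of_mul_le_mul_right this hY

/-- The one-dimensional dual program loses only a logarithmic factor. -/
theorem gammaOne_le_log_mul_lambdaStar (hπ : IsPosDistribution π) (hcard : 2 ≤ Fintype.card V)
    (hD : 2 ≤ maxDeg G) :
    gammaOne G π ≤ 50 * (lambdaStar G π 2 * Real.log (maxDeg G)) := by
  have hlog : 2 / 3 ≤ Real.log (maxDeg G) := by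
    have h1 : Real.log 2 ≤ Real.log (maxDeg G) :=
      Real.log_le_log two_pos (by exact_mod_cast hD)
    linarith [Real.log_two_gt_d9]
  set ℓ := Real.log (maxDeg G)
  have hℓ : 0 < ℓ := by linarith
  have hKpos : 0 < 8 * (ℓ + 1) ^ 2 / ℓ := by positivity
  have h1 : gammaOne G π / (8 * (ℓ + 1) ^ 2 / ℓ) ≤ lambdaStar G π 2 := by
    refine le_of_forall_gt_imp_ge_of_dense fun s hs => ?_
    obtain ⟨d, hd, g, hg, hdg, hgs⟩ := exists_convexHull_of_lambdaStar_lt hπ hcard hs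
    rw [div_le_iff₀' hKpos]
    exact gammaOne_le_of_convexHull hπ hD hd hg hdg hgs
  rw [div_le_iff₀' hKpos] at h1
  -- For ℓ ≥ 2/3 one has ℓ + 1 ≤ 5ℓ/2, and 8 · 25/4 = 50.
  have h2 : 8 * (ℓ + 1) ^ 2 / ℓ ≤ 50 * ℓ := by
    rw [div_le_iff₀ hℓ]
    nlinarith
  have h3 := lambdaStar_nonneg G hπ one_le_two hcard
  calc _ ≤ _ := h1
    _ ≤ 50 * ℓ * lambdaStar G π 2 := mul_le_mul_of_nonneg_right h2 h3
    _ = _ := by ring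

end VertexExpansion

/-! ### Assembling the bounds -/

namespace VertexExpansion

theorem not_adj_of_maxDeg_lt_two {V : Type*} [Fintype V] {G : SimpleGraph V}
    (h : maxDeg G < 2) (u v : V) : ¬ G.Adj u v := by
  intro huv
  have h1 : loopDegree G u ≤ maxDeg G := Finset.le_sup (f := loopDegree G) (Finset.mem_univ u)
  have h2 : ({u, v} : Set V).ncard ≤ loopDegree G u := by
    refine Set.ncard_le_ncard ?_ (Set.toFinite _)
    rintro x (rfl | rfl)
    · exact Or.inl rfl
    · exact Or.inr huv
  rw [Set.ncard_pair huv.ne] at h2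
  omega

/-- The improved Cheeger inequality for the reweighted eigenvalues. -/
theorem expansion_le_lambdaStar {V : Type*} [Fintype V] [DecidableEq V] {G : SimpleGraph V}
    {π : V → ℝ} (hπ : IsPosDistribution π) {k : ℕ} (hk2 : 2 ≤ k) (hk : k ≤ Fintype.card V)
    (hl : 0 < lambdaStar G π k) :
    expansion G π ≤ 3200 * ((k : ℝ) ^ (3 / 2 : ℝ) * lambdaStar G π 2 *
      Real.log (maxDeg G : ℝ) / √(lambdaStar G π k)) := by
  have hcard := hk2.trans hk
  have hk' : (0 : ℝ) < k := Nat.cast_pos.2 (by omega)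
  have hl2 := lambdaStar_nonneg G hπ one_le_two hcard
  have hlog : 0 ≤ Real.log (maxDeg G : ℝ) := Real.log_natCast_nonneg _
  -- When only the loops are present, log d gives no room, but ψ(G) = 0.
  rcases lt_or_ge (maxDeg G) 2 with hD | hD
  · rw [expansion_eq_zero_of_forall_not_adj hπ hcard (not_adj_of_maxDeg_lt_two hD)]
    positivity
  have hls := lambdaStar_le_sigmaStar G hπ (by omega : 1 ≤ k) hk
  have h1 := expansion_le_gammaOne hπ hk2 hk (hl.trans_le hls)
  have h2 := gammaOne_le_log_mul_lambdaStar (G := G) hπ hcard hD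
  have h3 : √(k / sigmaStar G π k) ≤ √k / √(lambdaStar G π k) := by
    rw [← Real.sqrt_div hk'.le]
    exact Real.sqrt_le_sqrt (div_le_div_of_nonneg_left hk'.le hl hls)
  have h4 : (k : ℝ) ^ (3 / 2 : ℝ) = k * √k := by
    rw [show (3 / 2 : ℝ) = 1 + 1 / 2 by norm_num, Real.rpow_add hk', Real.rpow_one,
      Real.sqrt_eq_rpow]
  have h5 := gammaOne_nonneg G hπ hcard
  calc expansion G π ≤ 64 * (k * gammaOne G π * √(k / sigmaStar G π k)) := h1
    _ ≤ 64 * (k * (50 * (lambdaStar G π 2 * Real.log (maxDeg G))) *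
        (√k / √(lambdaStar G π k))) := by gcongr
    _ = _ := by rw [h4]; ring

end VertexExpansion

theorem mainTheorem4 :
    ∃ C : ℝ, 0 < C ∧
      ∀ (V : Type*) [Fintype V] [DecidableEq V] (G : SimpleGraph V) (π : V → ℝ) (k : ℕ),
        VertexExpansion.IsPosDistribution π → 2 ≤ k → k ≤ Fintype.card V →
          (VertexExpansion.lambdaStar G π 2 ≤ C * VertexExpansion.expansion G π ∧
            (0 < VertexExpansion.lambdaStar G π k →
              VertexExpansion.expansion G π ≤
                C * ((k : ℝ) ^ (3 / 2 : ℝ) * VertexExpansion.lambdaStar G π 2 *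
                  Real.log (VertexExpansion.maxDeg G : ℝ) /
                    √(VertexExpansion.lambdaStar G π k)))) ∧
          (VertexExpansion.gammaOne G π ≤ C * VertexExpansion.expansion G π ∧
            (0 < VertexExpansion.sigmaStar G π k →
              VertexExpansion.expansion G π ≤
                C * ((k : ℝ) * VertexExpansion.gammaOne G π *
                  √((k : ℝ) / VertexExpansion.sigmaStar G π k)))) := by
  -- 3200 = 64 · 50: the Cheeger constant times the projection constant.
  refine ⟨3200, by norm_num, fun V _ _ G π k hπ hk2 hk => ?_⟩
  have hcard := hk2.trans hk
  have h0 := VertexExpansion.expansion_nonneg G hπ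
  refine ⟨⟨?_, VertexExpansion.expansion_le_lambdaStar hπ hk2 hk⟩, ?_, fun hσ => ?_⟩
  · linarith [VertexExpansion.lambdaStar_two_le_two_mul_expansion G hπ hcard]
  · linarith [VertexExpansion.gammaOne_le_two_mul_expansion G hπ hcard]
  · refine (VertexExpansion.expansion_le_gammaOne hπ hk2 hk hσ).trans
      (mul_le_mul_of_nonneg_right (by norm_num) ?_)
    have := VertexExpansion.gammaOne_nonneg G hπ hcard
    positivity
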